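/- Let $n\in\mathbb{N}$, $0<\alpha<n-1$ and $1<\rho<n$ (so $n\ge 2$), and let $\Omega\in L^{\rho}(\mathbb{S}^{n-1})$ be real-valued with $\int_{\mathbb{S}^{n-1}}\Omega\,d\sigma=0$. For $\phi:\mathbb{R}^n\to\mathbb{R}$ put $$T^{\alpha}(\phi)(x)=\mathrm{p.v.}\int_{\mathbb{R}^n}\frac{\Omega(y/|y|)}{|y|^{n-\alpha}}\,\phi(x-y)\,dy=\lim_{\varepsilon\to0^+,\,R\to+\infty}\int_{\{\varepsilon<|y|<R\}}\frac{\Omega(y/|y|)}{|y|^{n-\alpha}}\,\phi(x-y)\,dy .$$ Let $\frac{\rho n}{\rho n+\rho-n}<q<\frac{n}{1+\alpha}$ and $\mathfrak{s}=\frac{qn}{n-q(1+\alpha)}$. Then $\frac{\rho n}{\rho n+\rho-n}>1$ and $\mathfrak{s}>1$, and there is a constant $C$, depending only on $n,\alpha,\rho,q$ and $\Omega$, such that for every $C^1$ function $\phi:\mathbb{R}^n\to\mathbb{R}$ with $\nabla\phi\in L^q(\mathbb{R}^n)$ the principal value $T^{\alpha}(\phi)(x)$ exists for every $x\in\mathbb{R}^n$,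 the function $T^{\alpha}(\phi)$ belongs to $L^{\mathfrak{s}}(\mathbb{R}^n)$, and $$\|T^{\alpha}(\phi)\|_{L^{\mathfrak{s}}(\mathbb{R}^n)}\le C\,\|\nabla\phi\|_{L^q(\mathbb{R}^n)} .$$ -/

import Mathlib

open MeasureTheory Filter Topology
open scoped NNReal ENNReal

noncomputable section

/-- The rough kernel `y ↦ Ω(y/|y|) / |y|^(n-α)` on `ℝⁿ` (with the irrelevant value `0` at `y = 0`). -/
def roughKernel {n : ℕ} (Ω : Metric.sphere (0 : EuclideanSpace ℝ (Fin n)) 1 → ℝ) (α : ℝ)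
    (y : EuclideanSpace ℝ (Fin n)) : ℝ :=
  if hy : y = 0 then 0
  else Ω ⟨‖y‖⁻¹ • y, by simp [norm_smul, hy]⟩ / ‖y‖ ^ ((n : ℝ) - α)

/-- The open annulus `{y : ε < |y| < R}` in `ℝⁿ`. -/
def annulus (n : ℕ) (ε R : ℝ) : Set (EuclideanSpace ℝ (Fin n)) :=
  {y | ε < ‖y‖ ∧ ‖y‖ < R}

/-- `L` is the principal value of `∫ f` over `ℝⁿ`: `f` is Lebesgue integrable on every annulus
`{ε < |y| < R}` with `ε > 0`, and the integrals over these annuli tend to `L` as `ε → 0+` and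
`R → +∞` (independently of each other). -/
def HasPrincipalValue {n : ℕ} (f : EuclideanSpace ℝ (Fin n) → ℝ) (L : ℝ) : Prop :=
  (∀ ε R : ℝ, 0 < ε → IntegrableOn f (annulus n ε R) volume) ∧
    Tendsto (fun p : ℝ × ℝ => ∫ y in annulus n p.1 p.2, f y) (𝓝[>] (0 : ℝ) ×ˢ atTop) (𝓝 L)

/-- The principal value of `∫ f` over `ℝⁿ`; meaningful when `HasPrincipalValue f L` for some `L`,
and then equal to that `L`. -/
def principalValue {n : ℕ} (f : EuclideanSpace ℝ (Fin n) → ℝ) : ℝ :=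
  limUnder (𝓝[>] (0 : ℝ) ×ˢ (atTop : Filter ℝ))
    (fun p : ℝ × ℝ => ∫ y in annulus n p.1 p.2, f y)

/-- The rough operator `T^α φ (x) = p.v. ∫ Ω(y/|y|) / |y|^(n-α) φ(x - y) dy`. -/
def roughOperator {n : ℕ} (Ω : Metric.sphere (0 : EuclideanSpace ℝ (Fin n)) 1 → ℝ) (α : ℝ)
    (φ : EuclideanSpace ℝ (Fin n) → ℝ) (x : EuclideanSpace ℝ (Fin n)) : ℝ :=
  principalValue fun y => roughKernel Ω α y * φ (x - y)

end

/-!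
The operator is estimated scale by scale. On a dyadic annulus `{a < |y| < b}`, `b ≤ 2a`, the rough
kernel has mean zero because `∫ Ω = 0`, so a constant may be subtracted from `φ(x - ·)`. Hölder's
inequality with exponents `ρ` and `ρ' = ρ / (ρ - 1)` and the Sobolev–Poincaré inequality with
exponents `p` and `ρ'`, where `p = ρn / (ρn + ρ - n)` is exactly the exponent whose Sobolev conjugate
is `ρ'`, then give the bound `C a ^ (1 + α) (⨍_{B(x, 3a)} |∇φ| ^ p) ^ (1 / p)` for the integral over
the annulus (`exists_enorm_setIntegral_annulus_le`).

The average is at most `M(|∇φ| ^ p)(x) ^ (1 / p)`, with `M` the Hardy–Littlewood maximal function,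
and, by Jensen's inequality, at most a multiple of `a ^ (-n / q) ‖∇φ‖_q`. The first bound sums
geometrically over small scales because `1 + α > 0`, the second over large scales because
`1 + α < n / q`. As `M(|∇φ| ^ p)` is finite everywhere when `φ` is `C¹` and `∇φ ∈ L^q`, this gives the
existence of the principal value at every point (`exists_tendsto_of_doubling`). Splitting the scales
at the best place gives, as in Hedberg's proof of the Hardy–Littlewood–Sobolev theorem,
`|T φ(x)| ≤ C M(|∇φ| ^ p)(x) ^ ((1 - θ) / p) ‖∇φ‖_q ^ θ` with `θ = (1 + α) q / n`
(`exists_hasPrincipalValue_enorm_le`).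
Since `(1 - θ) s = q` and `q / p > 1`, the maximal theorem in `L ^ (q / p)` concludes
(`exists_eLpNorm_le_of_enorm_le_maximalFunction`).

The maximal theorem comes from Vitali's covering lemma, and the Sobolev–Poincaré inequality from the
Gagliardo–Nirenberg–Sobolev inequality for compactly supported functions and a Poincaré inequality
on balls.
-/

/-! ### The Hardy–Littlewood maximal function -/

section Maximal

open Metric Set Module

variable {E : Type*} [NormedAddCommGroup E] [MeasurableSpace E]

/-- The centred Hardy–Littlewood maximal function of `g`, with averages over open balls. -/
noncomputable def maximalFunction (μ : Measure E) (g : E → ℝ≥0∞) (x : E) : ℝ≥0∞ :=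
  ⨆ (r : ℝ) (_ : 0 < r), ⨍⁻ y in ball x r, g y ∂μ

theorem setLAverage_le_maximalFunction (μ : Measure E) (g : E → ℝ≥0∞) (x : E) {r : ℝ}
    (hr : 0 < r) : ⨍⁻ y in ball x r, g y ∂μ ≤ maximalFunction μ g x :=
  le_iSup₂ (f := fun (r : ℝ) (_ : 0 < r) => ⨍⁻ y in ball x r, g y ∂μ) r hr

theorem lowerSemicontinuous_measure_ball (ν : Measure E) (r : ℝ) :
    LowerSemicontinuous fun x => ν (ball x r) := by
  intro x c hc
  -- a slightly smaller ball still has measure `> c`, and it lies in the balls around nearby points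
  have hU : ball x r = ⋃ k : ℕ, ball x (r - 1 / ((k : ℝ) + 1)) := by
    ext y
    simp only [mem_ball, mem_iUnion]
    constructor
    · intro hy
      obtain ⟨k, hk⟩ := exists_nat_one_div_lt (sub_pos.2 hy)
      exact ⟨k, by linarith⟩
    · rintro ⟨k, hk⟩
      have : (0 : ℝ) < 1 / ((k : ℝ) + 1) := by positivity
      linarith
  have hmono : Monotone fun k : ℕ => ball x (r - 1 / ((k : ℝ) + 1)) := by
    intro i j hij
    apply ball_subset_ball
    have : 1 / ((j : ℝ) + 1) ≤ 1 / ((i : ℝ) + 1) := by gcongr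
    linarith
  change c < ν (ball x r) at hc
  rw [hU, hmono.measure_iUnion, lt_iSup_iff] at hc
  obtain ⟨k, hk⟩ := hc
  have hpos : (0 : ℝ) < 1 / ((k : ℝ) + 1) := by positivity
  filter_upwards [ball_mem_nhds x hpos] with y hy
  refine hk.trans_le (measure_mono (ball_subset_ball' ?_))
  rw [mem_ball, dist_comm] at hy
  linarith

variable [NormedSpace ℝ E] [FiniteDimensional ℝ E] (μ : Measure E) [μ.IsAddHaarMeasure]

theorem maximalFunction_le_add_truncation (g : E → ℝ≥0∞) (c : ℝ≥0∞) (x : E) :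
    maximalFunction μ g x ≤ c + maximalFunction μ ({y | c < g y}.indicator g) x := by
  refine iSup₂_le fun r hr => ?_
  have h0 : μ (ball x r) ≠ 0 := (measure_ball_pos μ x hr).ne'
  have h1 : μ (ball x r) ≠ ∞ := measure_ball_lt_top.ne
  calc ⨍⁻ y in ball x r, g y ∂μ
      ≤ ⨍⁻ y in ball x r, (c + {y | c < g y}.indicator g y) ∂μ := by
        refine lintegral_mono fun y => ?_
        by_cases h : c < g y
        · simp [indicator, h]
        · simpa [indicator, h] using not_lt.1 h
    _ = c + ⨍⁻ y in ball x r, {y | c < g y}.indicator g y ∂μ := by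
        rw [setLAverage_eq, setLAverage_eq, lintegral_add_left measurable_const,
          ENNReal.add_div, setLIntegral_const, ENNReal.mul_div_cancel_right h0 h1]
    _ ≤ _ := by gcongr; exact setLAverage_le_maximalFunction μ _ x hr

variable [BorelSpace E]

theorem lowerSemicontinuous_maximalFunction (g : E → ℝ≥0∞) :
    LowerSemicontinuous (maximalFunction μ g) := by
  refine lowerSemicontinuous_biSup fun r hr => ?_
  have h : ∀ x, ⨍⁻ y in ball x r, g y ∂μ = (μ.withDensity g) (ball x r) / μ (ball 0 r) := by
    intro x
    rw [setLAverage_eq, withDensity_apply _ measurableSet_ball, Measure.addHaar_ball_center]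
  simp_rw [h]
  intro x c hc
  have h0 : μ (ball (0 : E) r) ≠ 0 := (measure_ball_pos μ 0 hr).ne'
  have h1 : μ (ball (0 : E) r) ≠ ∞ := measure_ball_lt_top.ne
  rw [gt_iff_lt, ENNReal.lt_div_iff_mul_lt (Or.inl h0) (Or.inl h1)] at hc
  filter_upwards [lowerSemicontinuous_measure_ball (μ.withDensity g) r x _ hc] with y hy
  rwa [gt_iff_lt, ENNReal.lt_div_iff_mul_lt (Or.inl h0) (Or.inl h1)]

theorem measurable_maximalFunction (g : E → ℝ≥0∞) : Measurable (maximalFunction μ g) :=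
  (lowerSemicontinuous_maximalFunction μ g).measurable

/-- The weak type `(1, 1)` bound for the maximal function, by Vitali's covering lemma. -/
theorem mul_measure_lt_maximalFunction_le [Nontrivial E] (g : E → ℝ≥0∞) {c : ℝ≥0∞} (hc0 : c ≠ 0)
    (hc : c ≠ ∞) :
    c * μ {x | c < maximalFunction μ g x} ≤ 4 ^ finrank ℝ E * ∫⁻ y, g y ∂μ := by
  set I := ∫⁻ y, g y ∂μ with hI
  rcases eq_or_ne I ∞ with hI' | hI'
  · rw [hI', ENNReal.mul_top (by simp)]
    exact le_top
  set S := {x | c < maximalFunction μ g x}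
  have hS : ∀ x ∈ S, ∃ r : ℝ, 0 < r ∧ c * μ (ball x r) < ∫⁻ y in ball x r, g y ∂μ := by
    intro x hx
    have hx' : c < maximalFunction μ g x := hx
    simp only [maximalFunction, lt_iSup_iff] at hx'
    obtain ⟨r, hr, h⟩ := hx'
    refine ⟨r, hr, ?_⟩
    rwa [setLAverage_eq, ENNReal.lt_div_iff_mul_lt (Or.inl (measure_ball_pos μ x hr).ne')
      (Or.inl measure_ball_lt_top.ne)] at h
  choose! r hr0 hr using hS
  set v := μ (ball (0 : E) 1)
  have hv0 : v ≠ 0 := (measure_ball_pos μ 0 one_pos).ne'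
  have hv1 : v ≠ ∞ := measure_ball_lt_top.ne
  -- Vitali's lemma needs bounded radii: a ball of large radius has measure `> I / c`
  have hbound : ∀ x ∈ S, r x ≤ max 1 (I / (c * v)).toReal := by
    intro x hx
    rcases le_or_gt (r x) 1 with h1 | h1
    · exact h1.trans (le_max_left _ _)
    refine le_max_of_le_right ?_
    have h2 : c * (ENNReal.ofReal (r x ^ finrank ℝ E) * v) ≤ I := by
      rw [← Measure.addHaar_ball_of_pos μ x (hr0 x hx)]
      exact (hr x hx).le.trans (setLIntegral_le_lintegral _ _)
    have h3 : ENNReal.ofReal (r x) ≤ I / (c * v) := by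
      rw [ENNReal.le_div_iff_mul_le (Or.inl (mul_ne_zero hc0 hv0))
        (Or.inl (ENNReal.mul_ne_top hc hv1))]
      calc ENNReal.ofReal (r x) * (c * v)
          ≤ ENNReal.ofReal (r x ^ finrank ℝ E) * (c * v) := by
            gcongr
            exact le_self_pow₀ h1.le (finrank_pos (R := ℝ) (M := E)).ne'
        _ = c * (ENNReal.ofReal (r x ^ finrank ℝ E) * v) := by ring
        _ ≤ I := h2
    exact (ENNReal.ofReal_le_iff_le_toReal
      (ENNReal.div_ne_top hI' (mul_ne_zero hc0 hv0))).1 h3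
  obtain ⟨u, huS, hdisj, hcov⟩ := Vitali.exists_disjoint_subfamily_covering_enlargement_ball
    S id r _ hbound 4 (by norm_num)
  simp only [id] at hdisj hcov
  have hcount : u.Countable := hdisj.countable_of_isOpen (fun _ _ => isOpen_ball)
    fun x hx => ⟨x, mem_ball_self (hr0 x (huS hx))⟩
  have hsub : S ⊆ ⋃ x ∈ u, ball x (4 * r x) := by
    intro x hx
    obtain ⟨b, hb, h⟩ := hcov x hx
    exact mem_biUnion hb (h (mem_ball_self (hr0 x hx)))
  calc c * μ S ≤ c * ∑' x : u, μ (ball (x : E) (4 * r x)) := by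
        gcongr
        exact (measure_mono hsub).trans (measure_biUnion_le μ hcount _)
    _ = 4 ^ finrank ℝ E * ∑' x : u, c * μ (ball (x : E) (r x)) := by
        rw [← ENNReal.tsum_mul_left, ← ENNReal.tsum_mul_left]
        congr 1 with x
        rw [Measure.addHaar_ball_mul_of_pos μ _ (by norm_num : (0 : ℝ) < 4),
          Measure.addHaar_ball_center μ (x : E), ENNReal.ofReal_pow (by norm_num)]
        norm_num
        ring
    _ ≤ 4 ^ finrank ℝ E * ∑' x : u, ∫⁻ y in ball (x : E) (r x), g y ∂μ := by
        gcongr with x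
        exact (hr x (huS x.2)).le
    _ = 4 ^ finrank ℝ E * ∫⁻ y in ⋃ x ∈ u, ball x (r x), g y ∂μ := by
        rw [lintegral_biUnion hcount (fun _ _ => measurableSet_ball) hdisj]
    _ ≤ 4 ^ finrank ℝ E * I := by
        gcongr
        exact setLIntegral_le_lintegral _ _

/-- The Hardy–Littlewood maximal theorem in `L^t`, `t > 1`: the weak type bound is applied at each
height `c` to the part of `g` above `c / 2`, and the layer cake formula is used twice, for `μ` and
for the measure with density `g`. -/
theorem lintegral_maximalFunction_rpow_le [Nontrivial E] {t : ℝ} (ht : 1 < t) :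
    ∃ C : ℝ≥0, ∀ g : E → ℝ≥0∞, Measurable g → (∀ x, g x ≠ ∞) →
      (∀ x, maximalFunction μ g x ≠ ∞) →
      ∫⁻ x, maximalFunction μ g x ^ t ∂μ ≤ C * ∫⁻ x, g x ^ t ∂μ := by
  have ht0 : 0 < t := by linarith
  have ht1 : 0 < t - 1 := by linarith
  set D : ℝ≥0∞ := 4 ^ finrank ℝ E
  set K : ℝ≥0∞ := ENNReal.ofReal t * (2 * D) * (ENNReal.ofReal (t - 1))⁻¹ * 2 ^ (t - 1) with hK
  have hKtop : K ≠ ∞ := by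
    have : (ENNReal.ofReal (t - 1)) ≠ 0 := by simpa using ht
    simp only [hK, D]
    finiteness
  refine ⟨K.toNNReal, fun g hg hgtop hM => ?_⟩
  rw [ENNReal.coe_toNNReal hKtop]
  -- the powers of `c` leave the layer cake integrand of exponent `t - 1` for the density `g`
  have hweak : ∀ c : ℝ, 0 < c → μ {x | c < (maximalFunction μ g x).toReal} *
      ENNReal.ofReal (c ^ (t - 1)) ≤
      2 * D * ((μ.withDensity g) {x | c < (2 * g x).toReal} * ENNReal.ofReal (c ^ (t - 1 - 1))) := by
    intro c hc
    set c' : ℝ≥0∞ := ENNReal.ofReal (c / 2)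
    have hc'0 : c' ≠ 0 := by simp [c', hc]
    have hcc : ENNReal.ofReal c = c' + c' := by
      rw [← ENNReal.ofReal_add (by positivity) (by positivity)]; simp
    set h := {y | c' < g y}.indicator g
    have hset : MeasurableSet {y | c' < g y} := measurableSet_lt measurable_const hg
    have hsub : {x | c < (maximalFunction μ g x).toReal} ⊆ {x | c' < maximalFunction μ h x} := by
      intro x hx
      have h1 : ENNReal.ofReal c < maximalFunction μ g x :=
        (ENNReal.ofReal_lt_iff_lt_toReal hc.le (hM x)).2 hx
      have h2 := h1.trans_le (maximalFunction_le_add_truncation μ g c' x)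
      rw [hcc] at h2
      exact lt_of_add_lt_add_left h2
    have hset' : {y | c' < g y} = {x | c < (2 * g x).toReal} := by
      ext y
      simp only [mem_ofPred_eq]
      rw [← ENNReal.ofReal_lt_iff_lt_toReal hc.le (ENNReal.mul_ne_top (by simp) (hgtop y)), hcc,
        ← two_mul, ENNReal.mul_lt_mul_iff_right (by simp) (by simp)]
    have h3 := mul_measure_lt_maximalFunction_le μ h hc'0 ENNReal.ofReal_ne_top
    rw [lintegral_indicator hset, ← withDensity_apply _ hset, hset'] at h3
    have h4 : ENNReal.ofReal (c ^ (t - 1)) = 2 * c' * ENNReal.ofReal (c ^ (t - 1 - 1)) := by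
      rw [two_mul, ← hcc, ← ENNReal.ofReal_mul hc.le, ← Real.rpow_one_add' hc.le (by linarith)]
      congr 2; ring
    calc _ ≤ μ {x | c' < maximalFunction μ h x} * ENNReal.ofReal (c ^ (t - 1)) := by gcongr
      _ = 2 * (c' * μ {x | c' < maximalFunction μ h x}) * ENNReal.ofReal (c ^ (t - 1 - 1)) := by
        rw [h4]; ring
      _ ≤ 2 * (D * (μ.withDensity g) {x | c < (2 * g x).toReal}) *
          ENNReal.ofReal (c ^ (t - 1 - 1)) := by gcongr
      _ = _ := by ring
  have hmeas2 : AEMeasurable (fun x => (2 * g x).toReal) (μ.withDensity g) :=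
    (hg.const_mul 2).ennreal_toReal.aemeasurable
  have hlayer := lintegral_rpow_eq_lintegral_meas_lt_mul (μ.withDensity g)
    (Eventually.of_forall fun x => ENNReal.toReal_nonneg) hmeas2 ht1
  calc ∫⁻ x, maximalFunction μ g x ^ t ∂μ
      = ∫⁻ x, ENNReal.ofReal ((maximalFunction μ g x).toReal ^ t) ∂μ := by
        refine lintegral_congr fun x => ?_
        rw [← ENNReal.ofReal_rpow_of_nonneg ENNReal.toReal_nonneg ht0.le,
          ENNReal.ofReal_toReal (hM x)]
    _ = ENNReal.ofReal t * ∫⁻ c in Ioi (0 : ℝ), μ {x | c < (maximalFunction μ g x).toReal} *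
          ENNReal.ofReal (c ^ (t - 1)) :=
        lintegral_rpow_eq_lintegral_meas_lt_mul μ
          (Eventually.of_forall fun x => ENNReal.toReal_nonneg)
          (measurable_maximalFunction μ g).ennreal_toReal.aemeasurable ht0
    _ ≤ ENNReal.ofReal t * ∫⁻ c in Ioi (0 : ℝ), 2 * D *
          ((μ.withDensity g) {x | c < (2 * g x).toReal} * ENNReal.ofReal (c ^ (t - 1 - 1))) := by
        gcongr ENNReal.ofReal t * ?_
        exact setLIntegral_mono' measurableSet_Ioi hweak
    _ = ENNReal.ofReal t * (2 * D) * ((ENNReal.ofReal (t - 1))⁻¹ * (ENNReal.ofReal (t - 1) *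
          ∫⁻ c in Ioi (0 : ℝ),
          (μ.withDensity g) {x | c < (2 * g x).toReal} * ENNReal.ofReal (c ^ (t - 1 - 1)))) := by
        rw [lintegral_const_mul' _ _ (by simp only [D]; finiteness), ← mul_assoc,
          ← mul_assoc (ENNReal.ofReal (t - 1))⁻¹, ENNReal.inv_mul_cancel (by simpa using ht)
            ENNReal.ofReal_ne_top, one_mul]
    _ = ENNReal.ofReal t * (2 * D) * ((ENNReal.ofReal (t - 1))⁻¹ *
          ∫⁻ x, 2 ^ (t - 1) * g x ^ t ∂μ) := by
        rw [← hlayer, lintegral_withDensity_eq_lintegral_mul₀ hg.aemeasurable]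
        · congr 2
          refine lintegral_congr fun x => ?_
          rw [Pi.mul_apply, ← ENNReal.ofReal_rpow_of_nonneg ENNReal.toReal_nonneg ht1.le,
            ENNReal.ofReal_toReal (ENNReal.mul_ne_top (by simp) (hgtop x)),
            ENNReal.mul_rpow_of_nonneg _ _ ht1.le, mul_left_comm]
          congr 1
          conv_rhs => rw [show t = 1 + (t - 1) by ring,
            ENNReal.rpow_add_of_nonneg _ _ zero_le_one ht1.le, ENNReal.rpow_one]
        · exact ((hg.const_mul 2).ennreal_toReal.pow_const _).ennreal_ofReal.aemeasurable
    _ = K * ∫⁻ x, g x ^ t ∂μ := by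
        rw [lintegral_const_mul _ (hg.pow_const t), hK]
        ring

end Maximal

/-! ### Poincaré and Sobolev–Poincaré inequalities on balls -/

section Poincare

open Metric Set Module

variable {E : Type*} [NormedAddCommGroup E] [NormedSpace ℝ E]

theorem enorm_sub_rpow_le_lintegral_segment {ψ : E → ℝ} (hψ : ContDiff ℝ 1 ψ) {p : ℝ} (hp : 1 ≤ p)
    (x y : E) :
    ‖ψ y - ψ x‖ₑ ^ p ≤
      ‖y - x‖ₑ ^ p * ∫⁻ t in Icc (0 : ℝ) 1, ‖fderiv ℝ ψ (x + t • (y - x))‖ₑ ^ p := by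
  have hp0 : 0 < p := by linarith
  have hline : ContDiff ℝ 1 fun t : ℝ => x + t • (y - x) := by fun_prop
  have hcont : Continuous fun t : ℝ => fderiv ℝ ψ (x + t • (y - x)) :=
    (hψ.continuous_fderiv one_ne_zero).comp (by fun_prop)
  have h1 := enorm_sub_le_lintegral_deriv_of_contDiffOn_Icc
    (hψ.comp hline).contDiffOn (zero_le_one (α := ℝ))
  have hderiv : ∀ t : ℝ, deriv (ψ ∘ fun t : ℝ => x + t • (y - x)) t =
      fderiv ℝ ψ (x + t • (y - x)) (y - x) := by
    intro t
    have hd : HasDerivAt (fun t : ℝ => x + t • (y - x)) (y - x) t := by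
      simpa using ((hasDerivAt_id t).smul_const (y - x)).const_add x
    exact ((hψ.differentiable one_ne_zero _).hasFDerivAt.comp_hasDerivAt t hd).deriv
  simp only [hderiv, Function.comp_apply, one_smul, zero_smul, add_zero,
    add_sub_cancel] at h1
  have h2 : ‖ψ y - ψ x‖ₑ ≤
      ‖y - x‖ₑ * ∫⁻ t in Icc (0 : ℝ) 1, ‖fderiv ℝ ψ (x + t • (y - x))‖ₑ := by
    refine h1.trans ?_
    rw [← lintegral_const_mul' _ _ enorm_ne_top]
    refine lintegral_mono fun t => ?_
    rw [mul_comm]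
    exact ContinuousLinearMap.le_opENorm _ _
  have h3 : (∫⁻ t in Icc (0 : ℝ) 1, ‖fderiv ℝ ψ (x + t • (y - x))‖ₑ) ≤
      (∫⁻ t in Icc (0 : ℝ) 1, ‖fderiv ℝ ψ (x + t • (y - x))‖ₑ ^ p) ^ (1 / p) := by
    have : IsProbabilityMeasure ((volume : Measure ℝ).restrict (Icc (0 : ℝ) 1)) := ⟨by simp⟩
    have h4 := eLpNorm'_le_eLpNorm'_of_exponent_le (μ := (volume : Measure ℝ).restrict
      (Icc (0 : ℝ) 1)) one_pos hp hcont.aestronglyMeasurable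
    simpa [eLpNorm'] using h4
  calc ‖ψ y - ψ x‖ₑ ^ p
      ≤ (‖y - x‖ₑ * (∫⁻ t in Icc (0 : ℝ) 1, ‖fderiv ℝ ψ (x + t • (y - x))‖ₑ ^ p) ^ (1 / p)) ^ p := by
        gcongr
        exact h2.trans (by gcongr)
    _ = _ := by
        rw [ENNReal.mul_rpow_of_nonneg _ _ hp0.le, ← ENNReal.rpow_mul, one_div,
          inv_mul_cancel₀ hp0.ne', ENNReal.rpow_one]

variable [MeasurableSpace E] [BorelSpace E] [FiniteDimensional ℝ E] (μ : Measure E) [μ.IsAddHaarMeasure]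

theorem lintegral_comp_add_smul {f : E → ℝ≥0∞} (hf : Measurable f) (a : E) {r : ℝ} (hr : r ≠ 0) :
    ∫⁻ y, f (a + r • y) ∂μ = ENNReal.ofReal |(r ^ finrank ℝ E)⁻¹| * ∫⁻ y, f y ∂μ := by
  rw [← lintegral_add_left_eq_self f a (μ := μ), ← smul_eq_mul, ← lintegral_smul_measure,
    ← Measure.map_addHaar_smul μ hr, lintegral_map (by fun_prop) (by fun_prop)]

theorem lintegral_comp_add_smul_le {f : E → ℝ≥0∞} (hf : Measurable f) (a : E) {r : ℝ}
    (hr : 1 / 2 ≤ r) :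
    ∫⁻ y, f (a + r • y) ∂μ ≤ 2 ^ finrank ℝ E * ∫⁻ y, f y ∂μ := by
  have hr0 : 0 < r := by linarith
  rw [lintegral_comp_add_smul μ hf a hr0.ne']
  gcongr
  rw [abs_of_pos (by positivity), ← inv_pow, ENNReal.ofReal_pow (by positivity)]
  gcongr
  rw [show (2 : ℝ≥0∞) = ENNReal.ofReal 2 by simp]
  apply ENNReal.ofReal_le_ofReal
  rw [inv_le_comm₀ hr0 (by norm_num)]
  linarith

/-- Averaging over the segments joining two points of a ball. For each parameter `t`, one of the two
coefficients `1 - t` and `t` is at least `1 / 2`, and the corresponding endpoint is integrated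
first. -/
theorem lintegral_lintegral_segment_le {h : E → ℝ≥0∞} (hh : Measurable h) (B : Set E) :
    ∫⁻ x in B, ∫⁻ y in B, (∫⁻ t in Icc (0 : ℝ) 1, h (x + t • (y - x))) ∂μ ∂μ ≤
      2 ^ finrank ℝ E * μ B * ∫⁻ z, h z ∂μ := by
  have hm : Measurable fun z : (E × E) × ℝ => h (z.1.1 + z.2 • (z.1.2 - z.1.1)) :=
    hh.comp (by fun_prop)
  have hm1 : ∀ t : ℝ, Measurable fun z : E × E => h (z.1 + t • (z.2 - z.1)) := fun t =>
    hh.comp (by fun_prop)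
  have hswap : ∫⁻ x in B, ∫⁻ y in B, (∫⁻ t in Icc (0 : ℝ) 1, h (x + t • (y - x))) ∂μ ∂μ =
      ∫⁻ t in Icc (0 : ℝ) 1, ∫⁻ x in B, ∫⁻ y in B, h (x + t • (y - x)) ∂μ ∂μ := by
    rw [lintegral_lintegral (f := fun x y => ∫⁻ t in Icc (0 : ℝ) 1, h (x + t • (y - x)))
      hm.lintegral_prod_right'.aemeasurable, lintegral_lintegral_swap
        (f := fun (z : E × E) (t : ℝ) => h (z.1 + t • (z.2 - z.1))) hm.aemeasurable]
    refine lintegral_congr fun t => ?_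
    rw [lintegral_lintegral (f := fun x y => h (x + t • (y - x))) (hm1 t).aemeasurable]
  rw [hswap]
  have hle : ∀ t ∈ Icc (0 : ℝ) 1, ∫⁻ x in B, ∫⁻ y in B, h (x + t • (y - x)) ∂μ ∂μ ≤
      2 ^ finrank ℝ E * μ B * ∫⁻ z, h z ∂μ := by
    intro t ht
    rcases le_total (1 / 2) t with h2 | h2
    · calc ∫⁻ x in B, ∫⁻ y in B, h (x + t • (y - x)) ∂μ ∂μ
          ≤ ∫⁻ x in B, 2 ^ finrank ℝ E * ∫⁻ z, h z ∂μ ∂μ := by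
            refine lintegral_mono fun x => (setLIntegral_le_lintegral _ _).trans ?_
            refine le_trans (le_of_eq ?_) (lintegral_comp_add_smul_le μ hh (x - t • x) h2)
            refine lintegral_congr fun y => ?_
            congr 1; module
        _ = _ := by rw [setLIntegral_const]; ring
    · rw [lintegral_lintegral_swap (f := fun x y => h (x + t • (y - x))) (hm1 t).aemeasurable]
      calc ∫⁻ y in B, ∫⁻ x in B, h (x + t • (y - x)) ∂μ ∂μ
          ≤ ∫⁻ y in B, 2 ^ finrank ℝ E * ∫⁻ z, h z ∂μ ∂μ := by
            refine lintegral_mono fun y => (setLIntegral_le_lintegral _ _).trans ?_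
            refine le_trans (le_of_eq ?_)
              (lintegral_comp_add_smul_le μ hh (t • y) (r := 1 - t) (by linarith))
            refine lintegral_congr fun x => ?_
            congr 1; module
        _ = _ := by rw [setLIntegral_const]; ring
  calc _ ≤ ∫⁻ t in Icc (0 : ℝ) 1, 2 ^ finrank ℝ E * μ B * ∫⁻ z, h z ∂μ :=
        setLIntegral_mono' measurableSet_Icc hle
    _ = _ := by simp

/-- The **Poincaré inequality** on a ball. The constant that is subtracted is a value of the function
at a well-chosen point rather than its mean. -/
theorem exists_lintegral_enorm_sub_rpow_le {ψ : E → ℝ} (hψ : ContDiff ℝ 1 ψ) {p : ℝ} (hp : 1 ≤ p)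
    {R : ℝ} (hR : 0 < R) :
    ∃ c : ℝ, ∫⁻ x in ball 0 R, ‖ψ x - c‖ₑ ^ p ∂μ ≤
      2 ^ finrank ℝ E * ENNReal.ofReal (2 * R) ^ p *
        ∫⁻ x in ball 0 R, ‖fderiv ℝ ψ x‖ₑ ^ p ∂μ := by
  have hp0 : 0 < p := by linarith
  set B := ball (0 : E) R
  have hB0 : μ B ≠ 0 := (measure_ball_pos μ 0 hR).ne'
  have hB1 : μ B ≠ ∞ := measure_ball_lt_top.ne
  have hBm : MeasurableSet B := measurableSet_ball
  set h : E → ℝ≥0∞ := B.indicator fun x => ‖fderiv ℝ ψ x‖ₑ ^ p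
  have hcont : Continuous (fderiv ℝ ψ) := hψ.continuous_fderiv one_ne_zero
  have hhm : Measurable h := (hcont.enorm.measurable.pow_const p).indicator hBm
  have hpt : ∀ x ∈ B, ∀ y ∈ B, ‖ψ y - ψ x‖ₑ ^ p ≤
      ENNReal.ofReal (2 * R) ^ p * ∫⁻ t in Icc (0 : ℝ) 1, h (x + t • (y - x)) := by
    intro x hx y hy
    refine (enorm_sub_rpow_le_lintegral_segment hψ hp x y).trans ?_
    refine mul_le_mul' (ENNReal.rpow_le_rpow ?_ hp0.le) ?_
    · rw [← ofReal_norm]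
      apply ENNReal.ofReal_le_ofReal
      have h1 := norm_sub_le y x
      rw [mem_ball_zero_iff] at hx hy
      linarith
    · refine setLIntegral_mono' measurableSet_Icc fun t ht => ?_
      have hz : x + t • (y - x) ∈ B := (convex_ball (0 : E) R).add_smul_sub_mem hx hy ht
      simp only [h, indicator_of_mem hz, le_refl]
  have hmeas : Measurable fun x => ∫⁻ y in B, ‖ψ y - ψ x‖ₑ ^ p ∂μ := by
    have : Measurable fun z : E × E => ‖ψ z.2 - ψ z.1‖ₑ ^ p := by
      have := hψ.continuous
      exact Measurable.pow_const (by fun_prop) p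
    exact this.lintegral_prod_right'
  obtain ⟨x, hx, hle⟩ := exists_le_setLAverage hB0 hB1 hmeas.aemeasurable
  refine ⟨ψ x, hle.trans ?_⟩
  rw [setLAverage_eq]
  refine ENNReal.div_le_of_le_mul ?_
  have hm : Measurable fun z : (E × E) × ℝ => h (z.1.1 + z.2 • (z.1.2 - z.1.1)) :=
    hhm.comp (by fun_prop)
  calc ∫⁻ x in B, ∫⁻ y in B, ‖ψ y - ψ x‖ₑ ^ p ∂μ ∂μ
      ≤ ∫⁻ x in B, ∫⁻ y in B, (ENNReal.ofReal (2 * R) ^ p *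
          ∫⁻ t in Icc (0 : ℝ) 1, h (x + t • (y - x))) ∂μ ∂μ :=
        setLIntegral_mono' hBm fun x hx => setLIntegral_mono' hBm fun y hy => hpt x hx y hy
    _ = ENNReal.ofReal (2 * R) ^ p *
          ∫⁻ x in B, ∫⁻ y in B, (∫⁻ t in Icc (0 : ℝ) 1, h (x + t • (y - x))) ∂μ ∂μ := by
        have hc : ENNReal.ofReal (2 * R) ^ p ≠ ∞ := by finiteness
        rw [← lintegral_const_mul' _ _ hc]
        refine lintegral_congr fun x => ?_
        rw [lintegral_const_mul' _ _ hc]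
    _ ≤ ENNReal.ofReal (2 * R) ^ p * (2 ^ finrank ℝ E * μ B * ∫⁻ z, h z ∂μ) := by
        gcongr
        exact lintegral_lintegral_segment_le μ hhm B
    _ = _ := by rw [lintegral_indicator hBm]; ring

/-- The **Sobolev–Poincaré inequality** on balls, with a loss in the radius: a cutoff equal to `1` on
`ball 0 2` and supported in `ball 0 3` reduces it to the Gagliardo–Nirenberg–Sobolev inequality, and
the term where the cutoff is differentiated is controlled by the Poincaré inequality. -/
theorem exists_eLpNorm_sub_le_eLpNorm_fderiv [Nontrivial E] {p p' : ℝ} (hp : 1 ≤ p) (hp'0 : 0 ≤ p')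
    (hp' : p'⁻¹ = p⁻¹ - (finrank ℝ E : ℝ)⁻¹) :
    ∃ C : ℝ≥0, ∀ ψ : E → ℝ, ContDiff ℝ 1 ψ → ∃ c : ℝ,
      eLpNorm (fun x => ψ x - c) (ENNReal.ofReal p') (μ.restrict (ball 0 2)) ≤
        C * eLpNorm (fderiv ℝ ψ) (ENNReal.ofReal p) (μ.restrict (ball 0 3)) := by
  have hp0 : 0 < p := by linarith
  let χ : ContDiffBump (0 : E) := ⟨2, 3, by norm_num, by norm_num⟩
  have hχd : ContDiff ℝ 1 χ := χ.contDiff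
  obtain ⟨A, hA⟩ : ∃ A : ℝ, ∀ x, ‖fderiv ℝ χ x‖ ≤ A :=
    (χ.hasCompactSupport.fderiv ℝ).exists_bound_of_continuous (hχd.continuous_fderiv one_ne_zero)
  have hA0 : 0 ≤ A := (norm_nonneg _).trans (hA 0)
  set P : ℝ≥0∞ := (2 ^ finrank ℝ E * ENNReal.ofReal (2 * 3) ^ p) ^ (1 / p)
  have hP : P ≠ ∞ := by
    simp only [P]
    finiteness
  set G := SNormLESNormFDerivOfEqConst ℝ μ p
  refine ⟨G * (1 + A.toNNReal * P.toNNReal), fun ψ hψ => ?_⟩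
  obtain ⟨c, hc⟩ := exists_lintegral_enorm_sub_rpow_le μ hψ hp (R := 3) (by norm_num)
  refine ⟨c, ?_⟩
  have hψc : ContDiff ℝ 1 fun x => ψ x - c := hψ.sub contDiff_const
  have hfd : Continuous (fderiv ℝ ψ) := hψ.continuous_fderiv one_ne_zero
  set u : E → ℝ := fun x => χ x * (ψ x - c)
  have hu : ContDiff ℝ 1 u := hχd.mul hψc
  have hucs : HasCompactSupport u := χ.hasCompactSupport.mul_right
  have hpE : (Real.toNNReal p : ℝ) = p := Real.coe_toNNReal _ hp0.le
  have hGNS := eLpNorm_le_eLpNorm_fderiv_of_eq (F := ℝ) μ hu hucs (p := p.toNNReal) (p' := p'.toNNReal)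
    (by rw [← NNReal.coe_le_coe, hpE]; exact hp) finrank_pos
    (by push_cast; rw [hpE, Real.coe_toNNReal _ hp'0]; exact hp')
  rw [hpE] at hGNS
  change eLpNorm u (ENNReal.ofReal p') μ ≤ G * eLpNorm (fderiv ℝ u) (ENNReal.ofReal p) μ at hGNS
  have hpo : ENNReal.ofReal p ≠ 0 := by simpa using hp0
  have hPoin : eLpNorm (fun x => ψ x - c) (ENNReal.ofReal p) (μ.restrict (ball 0 3)) ≤
      P * eLpNorm (fderiv ℝ ψ) (ENNReal.ofReal p) (μ.restrict (ball 0 3)) := by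
    rw [eLpNorm_eq_lintegral_rpow_enorm_toReal hpo ENNReal.ofReal_ne_top,
      eLpNorm_eq_lintegral_rpow_enorm_toReal hpo ENNReal.ofReal_ne_top,
      ENNReal.toReal_ofReal hp0.le, ← ENNReal.mul_rpow_of_nonneg _ _ (by positivity)]
    gcongr
  have hsupp : ∀ x, x ∉ ball (0 : E) 3 → fderiv ℝ u x = 0 := by
    intro x hx
    have hx' : χ x = 0 := χ.zero_of_le_dist (not_lt.1 hx)
    have hmin : IsLocalMin χ x := Eventually.of_forall fun y => by rw [hx']; exact χ.nonneg
    have h1 := ((hχd.differentiable one_ne_zero x).hasFDerivAt.mul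
      (hψc.differentiable one_ne_zero x).hasFDerivAt).fderiv
    rw [hx', hmin.fderiv_eq_zero] at h1
    change fderiv ℝ (⇑χ * fun x => ψ x - c) x = 0
    simpa using h1
  have hrestr : eLpNorm (fderiv ℝ u) (ENNReal.ofReal p) (μ.restrict (ball 0 3)) =
      eLpNorm (fderiv ℝ u) (ENNReal.ofReal p) μ := by
    rw [← eLpNorm_norm, ← eLpNorm_norm (fderiv ℝ u)]
    refine eLpNorm_restrict_eq_of_support_subset fun x hx => ?_
    by_contra h
    exact hx (by simp [hsupp x h])
  have hpt : ∀ x, ‖fderiv ℝ u x‖ ≤ ‖fderiv ℝ ψ x‖ + ‖A * (ψ x - c)‖ := by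
    intro x
    have h1 : fderiv ℝ u x = χ x • fderiv ℝ ψ x + (ψ x - c) • fderiv ℝ χ x := by
      have := ((hχd.differentiable one_ne_zero x).hasFDerivAt.mul
        ((hψ.differentiable one_ne_zero x).hasFDerivAt.sub_const c)).fderiv
      exact this
    rw [h1]
    refine (norm_add_le _ _).trans ?_
    rw [norm_smul, norm_smul, norm_mul, Real.norm_of_nonneg hA0, Real.norm_of_nonneg χ.nonneg,
      mul_comm A]
    gcongr
    · exact mul_le_of_le_one_left (norm_nonneg _) χ.le_one
    · exact hA x
  calc eLpNorm (fun x => ψ x - c) (ENNReal.ofReal p') (μ.restrict (ball 0 2))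
      = eLpNorm u (ENNReal.ofReal p') (μ.restrict (ball 0 2)) := by
        refine eLpNorm_congr_ae ?_
        filter_upwards [ae_restrict_mem measurableSet_ball] with x hx
        rw [show u x = χ x * (ψ x - c) from rfl,
          χ.one_of_mem_closedBall (ball_subset_closedBall hx), one_mul]
    _ ≤ eLpNorm u (ENNReal.ofReal p') μ := eLpNorm_mono_measure _ Measure.restrict_le_self
    _ ≤ G * eLpNorm (fderiv ℝ u) (ENNReal.ofReal p) μ := hGNS
    _ = G * eLpNorm (fderiv ℝ u) (ENNReal.ofReal p) (μ.restrict (ball 0 3)) := by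
        congr 1
        exact hrestr.symm
    _ ≤ G * eLpNorm (fun x => ‖fderiv ℝ ψ x‖ + ‖A * (ψ x - c)‖) (ENNReal.ofReal p)
          (μ.restrict (ball 0 3)) := by
        gcongr
        exact eLpNorm_mono_real hpt
    _ ≤ G * (eLpNorm (fun x => ‖fderiv ℝ ψ x‖) (ENNReal.ofReal p) (μ.restrict (ball 0 3)) +
          eLpNorm (fun x => ‖A * (ψ x - c)‖) (ENNReal.ofReal p) (μ.restrict (ball 0 3))) := by
        gcongr
        refine eLpNorm_add_le hfd.norm.aestronglyMeasurable ?_ (by simpa using hp)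
        exact (continuous_const.mul hψc.continuous).norm.aestronglyMeasurable
    _ ≤ G * (eLpNorm (fderiv ℝ ψ) (ENNReal.ofReal p) (μ.restrict (ball 0 3)) + A.toNNReal *
          (P * eLpNorm (fderiv ℝ ψ) (ENNReal.ofReal p) (μ.restrict (ball 0 3)))) := by
        rw [eLpNorm_norm, eLpNorm_norm]
        gcongr
        refine (eLpNorm_const_smul_le (c := A) (f := fun x => ψ x - c)).trans ?_
        rw [Real.enorm_eq_ofReal hA0]
        exact mul_le_mul_right hPoin _
    _ = _ := by
        push_cast
        rw [ENNReal.coe_toNNReal hP]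
        ring

end Poincare

/-! ### Integration in polar coordinates -/

section Polar

open Metric Set Module

variable {E : Type*} [NormedAddCommGroup E] [NormedSpace ℝ E] [MeasurableSpace E] [BorelSpace E]
  [FiniteDimensional ℝ E] [Nontrivial E] (μ : Measure E) [μ.IsAddHaarMeasure]

/-- A function on `E` that is `f` in polar coordinates is in `L^p` as soon as `f` is. -/
theorem MeasureTheory.MemLp.of_polar {p : ℝ≥0∞} {f : sphere (0 : E) 1 × Ioi (0 : ℝ) → ℝ} {g : E → ℝ}
    (hf : MemLp f p (μ.toSphere.prod (Measure.volumeIoiPow (finrank ℝ E - 1))))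
    (hfg : ∀ x : ({0}ᶜ : Set E), g x = f (homeomorphUnitSphereProd E x)) : MemLp g p μ := by
  have hemb : MeasurableEmbedding ((↑) : ({0}ᶜ : Set E) → E) :=
    MeasurableEmbedding.subtype_coe (measurableSet_singleton _).compl
  rw [← restrict_compl_singleton (μ := μ) 0,
    ← map_comap_subtype_coe (measurableSet_singleton _).compl, hemb.memLp_map_measure_iff]
  have := hf.comp_measurePreserving μ.measurePreserving_homeomorphUnitSphereProd
  exact this.ae_eq (Eventually.of_forall fun x => (hfg x).symm)

theorem integral_eq_integral_polar {f : sphere (0 : E) 1 × Ioi (0 : ℝ) → ℝ} {g : E → ℝ}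
    (hfg : ∀ x : ({0}ᶜ : Set E), g x = f (homeomorphUnitSphereProd E x)) :
    ∫ x, g x ∂μ = ∫ z, f z ∂(μ.toSphere.prod (Measure.volumeIoiPow (finrank ℝ E - 1))) := by
  have h1 : ∫ x, g x ∂μ = ∫ x : ({0}ᶜ : Set E), g x ∂(μ.comap (↑)) := by
    rw [integral_subtype_comap (measurableSet_singleton _).compl, restrict_compl_singleton]
  rw [← μ.measurePreserving_homeomorphUnitSphereProd.integral_comp
    (Homeomorph.measurableEmbedding _), h1]
  exact integral_congr_ae (Eventually.of_forall hfg)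

theorem aestronglyMeasurable_of_polar {f : sphere (0 : E) 1 × Ioi (0 : ℝ) → ℝ} {g : E → ℝ}
    (hf : AEStronglyMeasurable f (μ.toSphere.prod (Measure.volumeIoiPow (finrank ℝ E - 1))))
    (hfg : ∀ x : ({0}ᶜ : Set E), g x = f (homeomorphUnitSphereProd E x)) :
    AEStronglyMeasurable g μ := by
  have hemb : MeasurableEmbedding ((↑) : ({0}ᶜ : Set E) → E) :=
    MeasurableEmbedding.subtype_coe (measurableSet_singleton _).compl
  rw [← restrict_compl_singleton (μ := μ) 0,
    ← map_comap_subtype_coe (measurableSet_singleton _).compl, hemb.aestronglyMeasurable_map_iff]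
  have := hf.comp_measurePreserving μ.measurePreserving_homeomorphUnitSphereProd
  exact this.congr (Eventually.of_forall fun x => (hfg x).symm)

end Polar

/-! ### The rough kernel on annuli -/

section RoughKernel

open Metric Set Module

variable {n : ℕ} {Ω : sphere (0 : EuclideanSpace ℝ (Fin n)) 1 → ℝ} {α : ℝ}

theorem measurableSet_annulus (ε R : ℝ) : MeasurableSet (annulus n ε R) :=
  (measurableSet_lt measurable_const measurable_norm).inter
    (measurableSet_lt measurable_norm measurable_const)

theorem annulus_subset_ball (ε R : ℝ) : annulus n ε R ⊆ ball 0 R := fun _ hy =>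
  mem_ball_zero_iff.2 hy.2

theorem roughKernel_smul {a : ℝ} (ha : 0 < a) (y : EuclideanSpace ℝ (Fin n)) :
    roughKernel Ω α (a • y) = a ^ (α - n) * roughKernel Ω α y := by
  rcases eq_or_ne y 0 with rfl | hy
  · simp [roughKernel]
  have hy' : a • y ≠ 0 := smul_ne_zero ha.ne' hy
  have h1 : ‖a • y‖⁻¹ • a • y = ‖y‖⁻¹ • y := by
    rw [norm_smul, Real.norm_of_nonneg ha.le, smul_smul, mul_inv, mul_right_comm,
      inv_mul_cancel₀ ha.ne', one_mul]
  simp only [roughKernel, hy, hy', dif_neg, not_false_eq_true, h1]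
  have h2 : ‖a • y‖ ^ ((n : ℝ) - α) = a ^ ((n : ℝ) - α) * ‖y‖ ^ ((n : ℝ) - α) := by
    rw [norm_smul, Real.norm_of_nonneg ha.le, Real.mul_rpow ha.le (norm_nonneg _)]
  rw [h2, ← neg_sub (n : ℝ) α, Real.rpow_neg ha.le]
  field_simp

theorem roughKernel_eq_polar (x : ({0}ᶜ : Set (EuclideanSpace ℝ (Fin n)))) :
    roughKernel Ω α x = Ω (homeomorphUnitSphereProd _ x).1 *
      ((homeomorphUnitSphereProd _ x).2 : ℝ) ^ (α - n) := by
  have hx : (x : EuclideanSpace ℝ (Fin n)) ≠ 0 := x.2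
  have h1 : (homeomorphUnitSphereProd _ x).1 =
      ⟨‖(x : EuclideanSpace ℝ (Fin n))‖⁻¹ • x, by simp [norm_smul, hx]⟩ := by
    ext1
    simp
  rw [h1, homeomorphUnitSphereProd_apply_snd_coe, roughKernel, dif_neg hx, div_eq_mul_inv,
    ← Real.rpow_neg (norm_nonneg _), neg_sub]

theorem aestronglyMeasurable_roughKernel [Nontrivial (EuclideanSpace ℝ (Fin n))]
    (hΩ : AEStronglyMeasurable Ω (volume : Measure (EuclideanSpace ℝ (Fin n))).toSphere) :
    AEStronglyMeasurable (roughKernel Ω α) volume := by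
  refine aestronglyMeasurable_of_polar volume (f := fun z => Ω z.1 * (z.2 : ℝ) ^ (α - n)) ?_
    roughKernel_eq_polar
  refine hΩ.comp_fst.mul (Measurable.aestronglyMeasurable ?_)
  fun_prop

/-- The kernel cut off to an annulus, in polar coordinates. -/
theorem indicator_annulus_roughKernel_eq_polar (ε R : ℝ)
    (x : ({0}ᶜ : Set (EuclideanSpace ℝ (Fin n)))) :
    (annulus n ε R).indicator (roughKernel Ω α) x =
      Ω (homeomorphUnitSphereProd _ x).1 * {r : Ioi (0 : ℝ) | ε < r ∧ (r : ℝ) < R}.indicator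
        (fun r => (r : ℝ) ^ (α - n)) (homeomorphUnitSphereProd _ x).2 := by
  by_cases hx : (x : EuclideanSpace ℝ (Fin n)) ∈ annulus n ε R
  · have hx' : (homeomorphUnitSphereProd _ x).2 ∈ {r : Ioi (0 : ℝ) | ε < r ∧ (r : ℝ) < R} := by
      simpa [annulus] using hx
    rw [indicator_of_mem hx, indicator_of_mem hx', roughKernel_eq_polar]
  · have hx' : (homeomorphUnitSphereProd _ x).2 ∉ {r : Ioi (0 : ℝ) | ε < r ∧ (r : ℝ) < R} := by
      simpa [annulus] using hx
    rw [indicator_of_notMem hx, indicator_of_notMem hx', mul_zero]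

theorem memLp_roughKernel_annulus [Nontrivial (EuclideanSpace ℝ (Fin n))] (hα : α < n) {ρ : ℝ≥0∞}
    (hΩ : MemLp Ω ρ (volume : Measure (EuclideanSpace ℝ (Fin n))).toSphere) {ε : ℝ} (hε : 0 < ε)
    (R : ℝ) : MemLp (roughKernel Ω α) ρ (volume.restrict (annulus n ε R)) := by
  rw [← memLp_indicator_iff_restrict (measurableSet_annulus ε R)]
  refine MemLp.of_polar volume (f := fun z => Ω z.1 *
      {r : Ioi (0 : ℝ) | ε < r ∧ (r : ℝ) < R}.indicator (fun r => (r : ℝ) ^ (α - n)) z.2) ?_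
    (indicator_annulus_roughKernel_eq_polar ε R)
  set S := {r : Ioi (0 : ℝ) | ε < r ∧ (r : ℝ) < R}
  have hS : MeasurableSet S :=
    (measurableSet_lt measurable_const measurable_subtype_coe).inter
      (measurableSet_lt measurable_subtype_coe measurable_const)
  set ν := Measure.volumeIoiPow (finrank ℝ (EuclideanSpace ℝ (Fin n)) - 1)
  have hfin : ν S < ∞ := by
    rcases le_or_gt R 0 with hR | hR
    · have : S = ∅ := by
        ext r
        simp only [S, mem_ofPred_eq, mem_empty_iff_false, iff_false, not_and, not_lt]
        intro h
        linarith
      simp [this]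
    · refine (measure_mono (t := Iio ⟨R, hR⟩) fun r hr => ?_).trans_lt ?_
      · exact hr.2
      · rw [Measure.volumeIoiPow_apply_Iio]
        exact ENNReal.ofReal_lt_top
  have : IsFiniteMeasure (ν.restrict S) := ⟨by simpa using hfin⟩
  have h1 := hΩ.comp_fst (ν.restrict S)
  have h2 : MemLp (fun z : sphere (0 : EuclideanSpace ℝ (Fin n)) 1 × Ioi (0 : ℝ) =>
      Ω z.1 * S.indicator (fun r => (r : ℝ) ^ (α - n)) z.2) ρ
      ((volume : Measure (EuclideanSpace ℝ (Fin n))).toSphere.prod (ν.restrict S)) := by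
    have hm : Measurable fun z : sphere (0 : EuclideanSpace ℝ (Fin n)) 1 × Ioi (0 : ℝ) =>
        S.indicator (fun r => (r : ℝ) ^ (α - n)) z.2 := by
      refine Measurable.comp (g := S.indicator fun r => (r : ℝ) ^ (α - n)) ?_ measurable_snd
      exact Measurable.indicator (by fun_prop) hS
    refine h1.of_le_mul (c := ε ^ (α - n)) (h1.1.mul hm.aestronglyMeasurable)
      (Eventually.of_forall fun z => ?_)
    rw [norm_mul, mul_comm]
    gcongr
    by_cases hz : z.2 ∈ S
    · rw [indicator_of_mem hz, Real.norm_of_nonneg (Real.rpow_nonneg z.2.2.le _)]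
      exact Real.rpow_le_rpow_of_nonpos hε hz.1.le (by linarith)
    · rw [indicator_of_notMem hz, norm_zero]
      positivity
  rw [← Measure.restrict_univ (μ := (volume : Measure (EuclideanSpace ℝ (Fin n))).toSphere),
    Measure.prod_restrict, ← memLp_indicator_iff_restrict (MeasurableSet.univ.prod hS)] at h2
  refine h2.ae_eq (Eventually.of_forall fun z => ?_)
  by_cases hz : z.2 ∈ S <;> simp [indicator, hz]

theorem setIntegral_roughKernel_annulus [Nontrivial (EuclideanSpace ℝ (Fin n))]
    (hΩ0 : ∫ ξ, Ω ξ ∂(volume : Measure (EuclideanSpace ℝ (Fin n))).toSphere = 0) (ε R : ℝ) :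
    ∫ y in annulus n ε R, roughKernel Ω α y = 0 := by
  rw [← integral_indicator (measurableSet_annulus ε R),
    integral_eq_integral_polar volume (f := fun z => Ω z.1 *
      {r : Ioi (0 : ℝ) | ε < r ∧ (r : ℝ) < R}.indicator (fun r => (r : ℝ) ^ (α - n)) z.2)
      (indicator_annulus_roughKernel_eq_polar ε R),
    integral_prod_mul Ω, hΩ0, zero_mul]

end RoughKernel

/-! ### Averages over balls -/

section Averages

open Metric Set Module

variable {E : Type*} [NormedAddCommGroup E] [NormedSpace ℝ E] [MeasurableSpace E]
  [FiniteDimensional ℝ E] (μ : Measure E) [μ.IsAddHaarMeasure]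

/-- Jensen's inequality between the `L^p` and `L^q` averages on a ball. -/
theorem setLAverage_rpow_le_eLpNorm {F : Type*} [NormedAddCommGroup F] {f : E → F}
    (hf : AEStronglyMeasurable f μ) {p q : ℝ} (hp : 0 < p) (hpq : p ≤ q) (x : E) {r : ℝ}
    (hr : 0 < r) :
    (⨍⁻ y in ball x r, ‖f y‖ₑ ^ p ∂μ) ^ (1 / p) ≤
      (μ (ball x r))⁻¹ ^ (1 / q) * eLpNorm f (ENNReal.ofReal q) μ := by
  have hq : 0 < q := hp.trans_le hpq
  have hB0 : μ (ball x r) ≠ 0 := (measure_ball_pos μ x hr).ne'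
  have hB1 : μ (ball x r) ≠ ∞ := measure_ball_lt_top.ne
  set ν := ((μ.restrict (ball x r)) univ)⁻¹ • μ.restrict (ball x r) with hν
  have : IsProbabilityMeasure ν := ⟨by
    rw [hν, Measure.smul_apply, smul_eq_mul, Measure.restrict_apply_univ,
      ENNReal.inv_mul_cancel hB0 hB1]⟩
  have h1 : eLpNorm' f p ν ≤ eLpNorm' f q ν :=
    eLpNorm'_le_eLpNorm'_of_exponent_le hp hpq ν (hf.restrict.smul_measure _)
  refine h1.trans ?_
  rw [eLpNorm'_eq_lintegral_enorm, hν, lintegral_smul_measure, Measure.restrict_apply_univ,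
    smul_eq_mul, ENNReal.mul_rpow_of_nonneg _ _ (by positivity),
    eLpNorm_eq_lintegral_rpow_enorm_toReal (by simpa using hq) ENNReal.ofReal_ne_top,
    ENNReal.toReal_ofReal hq.le]
  gcongr
  exact Measure.restrict_le_self

variable [BorelSpace E]

theorem setLIntegral_ball_comp_sub_smul {h : E → ℝ≥0∞} (hh : Measurable h) (x : E) {a R : ℝ}
    (ha : 0 < a) (hR : 0 < R) :
    ∫⁻ z in ball 0 R, h (x - a • z) ∂μ = μ (ball 0 R) * ⨍⁻ y in ball x (a * R), h y ∂μ := by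
  have h1 : ∀ z, (ball (0 : E) R).indicator (fun z => h (x - a • z)) z =
      (ball x (a * R)).indicator h (x + (-a) • z) := by
    intro z
    have hz : x + (-a) • z = x - a • z := by module
    rw [hz]
    have hiff : z ∈ ball (0 : E) R ↔ x - a • z ∈ ball x (a * R) := by
      rw [mem_ball_zero_iff, mem_ball_iff_norm, sub_sub_cancel_left, norm_neg, norm_smul,
        Real.norm_of_nonneg ha.le]
      exact (mul_lt_mul_iff_right₀ ha).symm
    by_cases hz' : z ∈ ball (0 : E) R
    · rw [indicator_of_mem hz', indicator_of_mem (hiff.1 hz')]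
    · rw [indicator_of_notMem hz', indicator_of_notMem (mt hiff.2 hz')]
  have hB0 : μ (ball (0 : E) R) ≠ 0 := (measure_ball_pos μ 0 hR).ne'
  have hB1 : μ (ball (0 : E) R) ≠ ∞ := measure_ball_lt_top.ne
  have hpow : (0 : ℝ) < a ^ finrank ℝ E := by positivity
  rw [← lintegral_indicator measurableSet_ball, lintegral_congr h1,
    lintegral_comp_add_smul μ (hh.indicator measurableSet_ball) x (neg_ne_zero.2 ha.ne'),
    lintegral_indicator measurableSet_ball, setLAverage_eq,
    Measure.addHaar_ball_mul_of_pos μ x ha R, abs_inv, abs_pow, abs_neg, abs_of_pos ha,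
    ENNReal.ofReal_inv_of_pos hpow, ENNReal.div_eq_inv_mul,
    ENNReal.mul_inv (Or.inr hB1) (Or.inr hB0), ← mul_assoc, mul_left_comm,
    ENNReal.mul_inv_cancel hB0 hB1, mul_one]

theorem maximalFunction_enorm_rpow_lt_top [Nontrivial E] {F : Type*} [NormedAddCommGroup F]
    {f : E → F} (hf : Continuous f) {p q : ℝ} (hp : 0 < p) (hpq : p ≤ q)
    (hfq : eLpNorm f (ENNReal.ofReal q) μ < ∞) (x : E) :
    maximalFunction μ (fun y => ‖f y‖ₑ ^ p) x < ∞ := by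
  obtain ⟨c, hc⟩ := (isCompact_closedBall x 1).exists_bound_of_continuousOn hf.continuousOn
  set A := (μ (ball x 1))⁻¹ ^ (1 / q) * eLpNorm f (ENNReal.ofReal q) μ with hA
  have hAtop : A < ∞ := by
    have h1 : (μ (ball x 1))⁻¹ ≠ ∞ := ENNReal.inv_ne_top.2 (measure_ball_pos μ x one_pos).ne'
    have hq : 0 ≤ 1 / q := one_div_nonneg.2 (hp.trans_le hpq).le
    exact ENNReal.mul_lt_top (ENNReal.rpow_lt_top_of_nonneg hq h1) hfq
  have hle : maximalFunction μ (fun y => ‖f y‖ₑ ^ p) x ≤ max (ENNReal.ofReal c ^ p) (A ^ p) := by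
    refine iSup₂_le fun r hr => ?_
    rcases le_total r 1 with h1 | h1
    · -- on small balls the average is at most the supremum of the continuous function `‖f ·‖`
      refine le_max_of_le_left ?_
      rw [setLAverage_eq]
      refine ENNReal.div_le_of_le_mul ?_
      rw [← setLIntegral_const]
      refine setLIntegral_mono' measurableSet_ball fun y hy => ?_
      gcongr
      rw [← ofReal_norm]
      exact ENNReal.ofReal_le_ofReal
        (hc y (closedBall_subset_closedBall h1 (ball_subset_closedBall hy)))
    · refine le_max_of_le_right ?_
      have h2 := (setLAverage_rpow_le_eLpNorm μ hf.aestronglyMeasurable hp hpq x hr).trans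
        (show _ ≤ A by
          have hq : 0 ≤ 1 / q := one_div_nonneg.2 (hp.trans_le hpq).le
          rw [hA]
          gcongr)
      rwa [one_div, ENNReal.rpow_inv_le_iff hp] at h2
  exact hle.trans_lt (max_lt (by finiteness) (by finiteness))

end Averages

/-! ### The operator at one scale -/

section AnnulusEstimate

open Metric Set Module
open scoped Pointwise

variable {n : ℕ} {Ω : sphere (0 : EuclideanSpace ℝ (Fin n)) 1 → ℝ} {α : ℝ}

theorem integrableOn_roughKernel_mul [Nontrivial (EuclideanSpace ℝ (Fin n))] (hα : α < n)
    (hΩ : Integrable Ω (volume : Measure (EuclideanSpace ℝ (Fin n))).toSphere)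
    {ψ : EuclideanSpace ℝ (Fin n) → ℝ} (hψ : Continuous ψ) {ε : ℝ} (hε : 0 < ε) (R : ℝ) :
    IntegrableOn (fun y => roughKernel Ω α y * ψ y) (annulus n ε R) := by
  have hK : IntegrableOn (roughKernel Ω α) (annulus n ε R) :=
    memLp_one_iff_integrable.1 (memLp_roughKernel_annulus hα (memLp_one_iff_integrable.2 hΩ) hε R)
  exact hK.mul_continuousOn_of_subset hψ.continuousOn (measurableSet_annulus ε R)
    (isCompact_closedBall 0 R) ((annulus_subset_ball ε R).trans ball_subset_closedBall)

/-- Because the kernel has mean zero on annuli, a constant may be subtracted from `ψ`; Hölder's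
inequality and the Sobolev–Poincaré inequality then bound the integral by the gradient. -/
theorem exists_enorm_setIntegral_annulus_one_le [Nontrivial (EuclideanSpace ℝ (Fin n))]
    (hα : α < n) {ρ p : ℝ} (hρ : 1 < ρ) (hp : 1 ≤ p)
    (hpρ : (ρ.conjExponent)⁻¹ = p⁻¹ - (n : ℝ)⁻¹)
    (hΩ : MemLp Ω (ENNReal.ofReal ρ) (volume : Measure (EuclideanSpace ℝ (Fin n))).toSphere)
    (hΩ0 : ∫ ξ, Ω ξ ∂(volume : Measure (EuclideanSpace ℝ (Fin n))).toSphere = 0) :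
    ∃ C : ℝ≥0, ∀ ψ : EuclideanSpace ℝ (Fin n) → ℝ, ContDiff ℝ 1 ψ → ∀ t : ℝ, t ≤ 2 →
      ‖∫ z in annulus n 1 t, roughKernel Ω α z * ψ z‖ₑ ≤
        C * eLpNorm (fderiv ℝ ψ) (ENNReal.ofReal p) (volume.restrict (ball 0 3)) := by
  have hconj : ρ.HolderConjugate ρ.conjExponent := Real.HolderConjugate.conjExponent hρ
  have hconj' := hconj.ennrealOfReal
  have hΩ1 : Integrable Ω (volume : Measure (EuclideanSpace ℝ (Fin n))).toSphere :=
    hΩ.integrable (by simpa using hρ.le)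
  obtain ⟨C, hC⟩ := exists_eLpNorm_sub_le_eLpNorm_fderiv
    (volume : Measure (EuclideanSpace ℝ (Fin n))) hp hconj.symm.pos.le (by simpa using hpρ)
  set D := eLpNorm (roughKernel Ω α) (ENNReal.ofReal ρ) (volume.restrict (annulus n 1 2)) with hD
  have hDtop : D ≠ ∞ := (memLp_roughKernel_annulus hα hΩ one_pos 2).2.ne
  refine ⟨D.toNNReal * C, fun ψ hψ t ht => ?_⟩
  obtain ⟨c, hc⟩ := hC ψ hψ
  have hψc : Continuous fun z => ψ z - c := hψ.continuous.sub continuous_const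
  have hsub : annulus n 1 t ⊆ annulus n 1 2 := fun y hy => ⟨hy.1, hy.2.trans_le ht⟩
  have h1 : ∫ z in annulus n 1 t, roughKernel Ω α z * ψ z =
      ∫ z in annulus n 1 t, roughKernel Ω α z * (ψ z - c) := by
    have hi1 := integrableOn_roughKernel_mul (α := α) hα hΩ1 hψ.continuous one_pos t
    have hi2 := integrableOn_roughKernel_mul (α := α) hα hΩ1
      (continuous_const (y := c)) one_pos t
    simp_rw [mul_sub]
    rw [integral_sub hi1 hi2, integral_mul_const, setIntegral_roughKernel_annulus hΩ0, zero_mul,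
      sub_zero]
  rw [h1]
  calc ‖∫ z in annulus n 1 t, roughKernel Ω α z * (ψ z - c)‖ₑ
      ≤ ∫⁻ z in annulus n 1 t, ‖roughKernel Ω α z * (ψ z - c)‖ₑ := enorm_integral_le_lintegral_enorm _
    _ ≤ ∫⁻ z in annulus n 1 2, ‖roughKernel Ω α z * (ψ z - c)‖ₑ := lintegral_mono_set hsub
    _ = eLpNorm (roughKernel Ω α • fun z => ψ z - c) 1 (volume.restrict (annulus n 1 2)) := by
        rw [eLpNorm_one_eq_lintegral_enorm]; rfl
    _ ≤ D * eLpNorm (fun z => ψ z - c) (ENNReal.ofReal ρ.conjExponent)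
          (volume.restrict (annulus n 1 2)) :=
        eLpNorm_smul_le_mul_eLpNorm hψc.aestronglyMeasurable
          (memLp_roughKernel_annulus hα hΩ one_pos 2).1
    _ ≤ D * eLpNorm (fun z => ψ z - c) (ENNReal.ofReal ρ.conjExponent)
          (volume.restrict (ball 0 2)) := by
        gcongr
        exact annulus_subset_ball 1 2
    _ ≤ D * (C * eLpNorm (fderiv ℝ ψ) (ENNReal.ofReal p) (volume.restrict (ball 0 3))) := by
        gcongr
    _ = _ := by
        push_cast
        rw [ENNReal.coe_toNNReal hDtop, mul_assoc]

theorem setIntegral_annulus_comp_smul {a : ℝ} (ha : 0 < a) (b : ℝ)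
    (φ : EuclideanSpace ℝ (Fin n) → ℝ) (x : EuclideanSpace ℝ (Fin n)) :
    ∫ y in annulus n a b, roughKernel Ω α y * φ (x - y) =
      a ^ α * ∫ z in annulus n 1 (b / a), roughKernel Ω α z * φ (x - a • z) := by
  have hset : a • annulus n 1 (b / a) = annulus n a b := by
    ext y
    rw [mem_smul_set_iff_inv_smul_mem₀ ha.ne']
    simp only [annulus, mem_ofPred_eq, norm_smul, norm_inv, Real.norm_of_nonneg ha.le]
    rw [← div_eq_inv_mul, one_lt_div ha, div_lt_div_iff_of_pos_right ha]
  have h1 := Measure.setIntegral_comp_smul_of_pos volume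
    (fun y => roughKernel Ω α y * φ (x - y)) (annulus n 1 (b / a)) ha
  simp only [roughKernel_smul ha, hset, mul_assoc, integral_const_mul, smul_eq_mul,
    finrank_euclideanSpace, Fintype.card_fin] at h1
  have h2 : a ^ α = a ^ n * a ^ (α - n) := by
    rw [← Real.rpow_natCast, ← Real.rpow_add ha]
    congr 1; ring
  rw [h2, mul_assoc, h1, ← mul_assoc, mul_inv_cancel₀ (by positivity), one_mul]

/-- The estimate at scale `a`, by dilation of the estimate at scale `1`. -/
theorem exists_enorm_setIntegral_annulus_le [Nontrivial (EuclideanSpace ℝ (Fin n))]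
    (hα : α < n) {ρ p : ℝ} (hρ : 1 < ρ) (hp : 1 ≤ p)
    (hpρ : (ρ.conjExponent)⁻¹ = p⁻¹ - (n : ℝ)⁻¹)
    (hΩ : MemLp Ω (ENNReal.ofReal ρ) (volume : Measure (EuclideanSpace ℝ (Fin n))).toSphere)
    (hΩ0 : ∫ ξ, Ω ξ ∂(volume : Measure (EuclideanSpace ℝ (Fin n))).toSphere = 0) :
    ∃ C : ℝ≥0, ∀ φ : EuclideanSpace ℝ (Fin n) → ℝ, ContDiff ℝ 1 φ →
      ∀ (x : EuclideanSpace ℝ (Fin n)) (a b : ℝ), 0 < a → b ≤ 2 * a →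
      ‖∫ y in annulus n a b, roughKernel Ω α y * φ (x - y)‖ₑ ≤
        C * ENNReal.ofReal (a ^ (1 + α)) *
          (⨍⁻ y in ball x (a * 3), ‖fderiv ℝ φ y‖ₑ ^ p ∂volume) ^ (1 / p) := by
  obtain ⟨C, hC⟩ := exists_enorm_setIntegral_annulus_one_le hα hρ hp hpρ hΩ hΩ0
  have hp0 : 0 < p := by linarith
  set V := volume (ball (0 : EuclideanSpace ℝ (Fin n)) 3) ^ (1 / p) with hV
  have hVtop : V ≠ ∞ := ENNReal.rpow_ne_top_of_nonneg (by positivity) measure_ball_lt_top.ne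
  refine ⟨C * V.toNNReal, fun φ hφ x a b ha hb => ?_⟩
  set ψ : EuclideanSpace ℝ (Fin n) → ℝ := fun z => φ (x - a • z)
  have hψ : ContDiff ℝ 1 ψ := hφ.comp (by fun_prop)
  have hfd : ∀ z, ‖fderiv ℝ ψ z‖ₑ = ENNReal.ofReal a * ‖fderiv ℝ φ (x - a • z)‖ₑ := by
    intro z
    have hd : HasFDerivAt (fun z : EuclideanSpace ℝ (Fin n) => x - a • z)
        (-(a • ContinuousLinearMap.id ℝ (EuclideanSpace ℝ (Fin n)))) z :=
      ((hasFDerivAt_id z).const_smul a).const_sub x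
    have h1 : fderiv ℝ ψ z = -(a • fderiv ℝ φ (x - a • z)) := by
      have h2 := ((hφ.differentiable one_ne_zero _).hasFDerivAt.comp z hd).fderiv
      change fderiv ℝ ψ z = _ at h2
      rw [h2]
      ext v
      simp
    rw [h1, enorm_neg, enorm_smul, Real.enorm_eq_ofReal ha.le]
  have hnorm : eLpNorm (fderiv ℝ ψ) (ENNReal.ofReal p) (volume.restrict (ball 0 3)) =
      ENNReal.ofReal a * (V * (⨍⁻ y in ball x (a * 3), ‖fderiv ℝ φ y‖ₑ ^ p ∂volume) ^ (1 / p)) := by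
    have hm : Measurable fun y => ‖fderiv ℝ φ y‖ₑ ^ p :=
      (hφ.continuous_fderiv one_ne_zero).enorm.measurable.pow_const p
    rw [eLpNorm_eq_lintegral_rpow_enorm_toReal (by simpa using hp0) ENNReal.ofReal_ne_top,
      ENNReal.toReal_ofReal hp0.le]
    simp_rw [hfd, ENNReal.mul_rpow_of_nonneg _ _ hp0.le]
    rw [lintegral_const_mul' _ _ (by finiteness), ENNReal.mul_rpow_of_nonneg _ _ (by positivity),
      ← ENNReal.rpow_mul, mul_one_div_cancel hp0.ne', ENNReal.rpow_one,
      setLIntegral_ball_comp_sub_smul volume hm x ha (by norm_num),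
      ENNReal.mul_rpow_of_nonneg _ _ (by positivity)]
  rw [setIntegral_annulus_comp_smul ha, enorm_mul, Real.enorm_eq_ofReal (by positivity)]
  refine (mul_le_mul_right (hC ψ hψ (b / a) (by rwa [div_le_iff₀ ha])) _).trans (le_of_eq ?_)
  rw [hnorm, Real.rpow_add ha, Real.rpow_one, ENNReal.ofReal_mul ha.le]
  push_cast
  rw [ENNReal.coe_toNNReal hVtop]
  ring

end AnnulusEstimate

/-! ### Summation over scales -/

section AdditiveIntervalFunctions

variable {G : ℝ → ℝ → ℝ} {D D₁ D₂ γ γ₁ γ₂ : ℝ}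

theorem two_rpow_neg_lt_one (hγ : 0 < γ) : (2 : ℝ) ^ (-γ) < 1 :=
  Real.rpow_lt_one_of_one_lt_of_neg one_lt_two (neg_lt_zero.2 hγ)

/-- The principle of induction on the number of doublings needed to get from `a` to `b`. -/
theorem doubling_induction {P : ℝ → ℝ → Prop}
    (h : ∀ a b, 0 < a → a ≤ b → (2 * a < b → P a (b / 2) ∧ P (2 * a) b) → P a b) {a b : ℝ}
    (ha : 0 < a) (hab : a ≤ b) : P a b := by
  have key : ∀ N : ℕ, ∀ a b, 0 < a → a ≤ b → b ≤ 2 ^ N * a → P a b := by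
    intro N
    induction N with
    | zero =>
      intro a b ha hab hb
      exact h a b ha hab fun h2 => by simp only [pow_zero, one_mul] at hb; linarith
    | succ N ih =>
      intro a b ha hab hb
      rw [pow_succ] at hb
      exact h a b ha hab fun h2 =>
        ⟨ih a (b / 2) ha (by linarith) (by linarith),
          ih (2 * a) b (by linarith) h2.le (by linarith)⟩
  obtain ⟨N, hN⟩ := pow_unbounded_of_one_lt (b / a) one_lt_two
  exact key N a b ha hab ((div_lt_iff₀ ha).1 hN).le

/-- A geometric sum over the dyadic scales below `b`. -/
theorem abs_le_mul_rpow_right_of_doubling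
    (hadd : ∀ a b c, 0 < a → a ≤ b → b ≤ c → G a c = G a b + G b c) (hγ : 0 < γ) (hD : 0 ≤ D)
    (hG : ∀ a b, 0 < a → a ≤ b → b ≤ 2 * a → |G a b| ≤ D * a ^ γ) {a b : ℝ} (ha : 0 < a)
    (hab : a ≤ b) : |G a b| ≤ D / (1 - 2 ^ (-γ)) * b ^ γ := by
  have hlt := two_rpow_neg_lt_one hγ
  have hw : (0 : ℝ) < 2 ^ (-γ) := by positivity
  set w : ℝ := 2 ^ (-γ)
  have h1w : 0 < 1 - w := by linarith
  have hS : D / (1 - w) * w + D * w ≤ D / (1 - w) := by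
    have h1 : D / (1 - w) * (1 - w) = D := div_mul_cancel₀ _ h1w.ne'
    nlinarith
  refine doubling_induction (P := fun a b => |G a b| ≤ D / (1 - w) * b ^ γ) ?_ ha hab
  intro a b ha hab ih
  have hb : 0 < b := ha.trans_le hab
  rcases le_or_gt b (2 * a) with h2 | h2
  · refine (hG a b ha hab h2).trans ?_
    gcongr
    exact le_div_self hD h1w (by linarith)
  · have hhalf : (b / 2) ^ γ = w * b ^ γ := by
      rw [div_eq_mul_inv, Real.mul_rpow hb.le (by norm_num), Real.inv_rpow (by norm_num),
        ← Real.rpow_neg (by norm_num), mul_comm]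
    have h3 := (ih h2).1
    have h4 := hG (b / 2) b (by linarith) (by linarith) (by linarith)
    rw [hhalf] at h3 h4
    rw [hadd a (b / 2) b ha (by linarith) (by linarith)]
    calc |G a (b / 2) + G (b / 2) b| ≤ D / (1 - w) * (w * b ^ γ) + D * (w * b ^ γ) :=
          (abs_add_le _ _).trans (add_le_add h3 h4)
      _ = (D / (1 - w) * w + D * w) * b ^ γ := by ring
      _ ≤ _ := by gcongr

/-- A geometric sum over the dyadic scales above `a`. -/
theorem abs_le_mul_rpow_left_of_doubling
    (hadd : ∀ a b c, 0 < a → a ≤ b → b ≤ c → G a c = G a b + G b c) (hγ : 0 < γ) (hD : 0 ≤ D)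
    (hG : ∀ a b, 0 < a → a ≤ b → b ≤ 2 * a → |G a b| ≤ D * a ^ (-γ)) {a b : ℝ} (ha : 0 < a)
    (hab : a ≤ b) : |G a b| ≤ D / (1 - 2 ^ (-γ)) * a ^ (-γ) := by
  have hlt := two_rpow_neg_lt_one hγ
  have hw : (0 : ℝ) < 2 ^ (-γ) := by positivity
  set w : ℝ := 2 ^ (-γ) with hwdef
  have h1w : 0 < 1 - w := by linarith
  have hS : D + D / (1 - w) * w = D / (1 - w) := by
    field_simp
    ring
  refine doubling_induction (P := fun a b => |G a b| ≤ D / (1 - w) * a ^ (-γ)) ?_ ha hab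
  intro a b ha hab ih
  rcases le_or_gt b (2 * a) with h2 | h2
  · refine (hG a b ha hab h2).trans ?_
    gcongr
    exact le_div_self hD h1w (by linarith)
  · have h3 := (ih h2).2
    have h4 := hG a (2 * a) ha (by linarith) le_rfl
    rw [Real.mul_rpow (by norm_num) ha.le, ← hwdef] at h3
    rw [hadd a (2 * a) b ha (by linarith) h2.le]
    calc |G a (2 * a) + G (2 * a) b| ≤ D * a ^ (-γ) + D / (1 - w) * (w * a ^ (-γ)) :=
          (abs_add_le _ _).trans (add_le_add h4 h3)
      _ = (D + D / (1 - w) * w) * a ^ (-γ) := by ring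
      _ = _ := by rw [hS]

/-- An additive function of intervals with geometric decay at both ends of `(0, ∞)` has a limit
along `(0, ∞)`, and this limit is controlled by splitting `(0, ∞)` at any point `δ`. -/
theorem exists_tendsto_of_doubling
    (hadd : ∀ a b c, 0 < a → a ≤ b → b ≤ c → G a c = G a b + G b c)
    (hγ₁ : 0 < γ₁) (hγ₂ : 0 < γ₂) (hD₁ : 0 ≤ D₁) (hD₂ : 0 ≤ D₂)
    (hG₁ : ∀ a b, 0 < a → a ≤ b → b ≤ 2 * a → |G a b| ≤ D₁ * a ^ γ₁)
    (hG₂ : ∀ a b, 0 < a → a ≤ b → b ≤ 2 * a → |G a b| ≤ D₂ * a ^ (-γ₂)) :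
    ∃ L : ℝ, Tendsto (fun z : ℝ × ℝ => G z.1 z.2) (𝓝[>] (0 : ℝ) ×ˢ atTop) (𝓝 L) ∧
      ∀ δ, 0 < δ →
        |L| ≤ D₁ / (1 - 2 ^ (-γ₁)) * δ ^ γ₁ + D₂ / (1 - 2 ^ (-γ₂)) * δ ^ (-γ₂) := by
  have hs := fun {a b} => abs_le_mul_rpow_right_of_doubling (a := a) (b := b) hadd hγ₁ hD₁ hG₁
  have hl := fun {a b} => abs_le_mul_rpow_left_of_doubling (a := a) (b := b) hadd hγ₂ hD₂ hG₂
  set S₁ := D₁ / (1 - 2 ^ (-γ₁))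
  set S₂ := D₂ / (1 - 2 ^ (-γ₂))
  have hS₁ : 0 ≤ S₁ := div_nonneg hD₁ (by linarith [two_rpow_neg_lt_one hγ₁])
  have hS₂ : 0 ≤ S₂ := div_nonneg hD₂ (by linarith [two_rpow_neg_lt_one hγ₂])
  have hlim₁ : ∃ L₁, Tendsto (fun a => G a 1) (𝓝[>] (0 : ℝ)) (𝓝 L₁) := by
    rw [← cauchy_map_iff_exists_tendsto, Metric.cauchy_iff]
    refine ⟨inferInstance, fun ε hε => ?_⟩
    have hsmall : ∀ᶠ a in 𝓝[>] (0 : ℝ), S₁ * a ^ γ₁ < ε ∧ a < 1 ∧ 0 < a := by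
      have h1 : Tendsto (fun a : ℝ => S₁ * a ^ γ₁) (𝓝[>] 0) (𝓝 (S₁ * 0 ^ γ₁)) :=
        ((Real.continuousAt_rpow_const 0 γ₁ (Or.inr hγ₁.le)).tendsto.mono_left
          nhdsWithin_le_nhds).const_mul S₁
      rw [Real.zero_rpow hγ₁.ne', mul_zero] at h1
      filter_upwards [h1.eventually_lt_const hε, Ioo_mem_nhdsGT one_pos] with a h2 h3
      exact ⟨h2, h3.2, h3.1⟩
    refine ⟨_, image_mem_map hsmall, ?_⟩
    have key : ∀ a b, 0 < a → a ≤ b → b < 1 → S₁ * b ^ γ₁ < ε → |G a 1 - G b 1| < ε := by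
      intro a b ha hab hb h1
      rw [hadd a b 1 ha hab hb.le, add_sub_cancel_right]
      exact (hs ha hab).trans_lt h1
    rintro _ ⟨a, ⟨ha1, ha2, ha3⟩, rfl⟩ _ ⟨b, ⟨hb1, hb2, hb3⟩, rfl⟩
    rw [Real.dist_eq]
    rcases le_total a b with hab | hab
    · exact key a b ha3 hab hb2 hb1
    · rw [abs_sub_comm]
      exact key b a hb3 hab ha2 ha1
  have hlim₂ : ∃ L₂, Tendsto (fun b => G 1 b) atTop (𝓝 L₂) := by
    rw [← cauchy_map_iff_exists_tendsto, Metric.cauchy_iff]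
    refine ⟨inferInstance, fun ε hε => ?_⟩
    have hsmall : ∀ᶠ a in atTop, S₂ * a ^ (-γ₂) < ε ∧ 1 < a := by
      have h1 : Tendsto (fun a : ℝ => S₂ * a ^ (-γ₂)) atTop (𝓝 (S₂ * 0)) :=
        (tendsto_rpow_neg_atTop hγ₂).const_mul S₂
      rw [mul_zero] at h1
      filter_upwards [h1.eventually_lt_const hε, eventually_gt_atTop 1] with a h2 h3
      exact ⟨h2, h3⟩
    refine ⟨_, image_mem_map hsmall, ?_⟩
    have key : ∀ a b, 1 < a → a ≤ b → S₂ * a ^ (-γ₂) < ε → |G 1 b - G 1 a| < ε := by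
      intro a b ha hab h1
      rw [hadd 1 a b one_pos ha.le hab, add_sub_cancel_left]
      exact (hl (one_pos.trans ha) hab).trans_lt h1
    rintro _ ⟨a, ⟨ha1, ha2⟩, rfl⟩ _ ⟨b, ⟨hb1, hb2⟩, rfl⟩
    rw [Real.dist_eq]
    rcases le_total a b with hab | hab
    · rw [abs_sub_comm]
      exact key a b ha2 hab ha1
    · exact key b a hb2 hab hb1
  obtain ⟨L₁, h₁⟩ := hlim₁
  obtain ⟨L₂, h₂⟩ := hlim₂
  have hsplit : ∀ δ, 0 < δ → ∀ᶠ z : ℝ × ℝ in 𝓝[>] (0 : ℝ) ×ˢ atTop,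
      0 < z.1 ∧ z.1 ≤ δ ∧ δ ≤ z.2 := by
    intro δ hδ
    have h3 : ∀ᶠ a in 𝓝[>] (0 : ℝ), 0 < a ∧ a ≤ δ := by
      filter_upwards [Ioo_mem_nhdsGT hδ] with a ha
      exact ⟨ha.1, ha.2.le⟩
    filter_upwards [h3.prod_mk (eventually_ge_atTop δ)] with z hz
    exact ⟨hz.1.1, hz.1.2, hz.2⟩
  have hL : Tendsto (fun z : ℝ × ℝ => G z.1 z.2) (𝓝[>] (0 : ℝ) ×ˢ atTop) (𝓝 (L₁ + L₂)) := by
    refine ((h₁.comp tendsto_fst).add (h₂.comp tendsto_snd)).congr' ?_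
    filter_upwards [hsplit 1 one_pos] with z hz
    exact (hadd _ _ _ hz.1 hz.2.1 hz.2.2).symm
  refine ⟨L₁ + L₂, hL, fun δ hδ => le_of_tendsto hL.abs ?_⟩
  filter_upwards [hsplit δ hδ] with z hz
  rw [hadd _ _ _ hz.1 hz.2.1 hz.2.2]
  exact (abs_add_le _ _).trans (add_le_add (hs hz.1 hz.2.1) (hl hδ hz.2.2))

/-- Optimising the splitting point `δ`. -/
theorem le_two_mul_rpow_of_forall_le {L A m N β κ : ℝ} (hA : 0 ≤ A) (hm : 0 ≤ m) (hN : 0 ≤ N)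
    (hβ : 0 < β) (hβκ : β < κ)
    (h : ∀ δ : ℝ, 0 < δ → L ≤ A * (m * δ ^ β + N * δ ^ (-(κ - β)))) :
    L ≤ 2 * A * (m ^ (1 - β / κ) * N ^ (β / κ)) := by
  have hκ : 0 < κ := hβ.trans hβκ
  have hθ : 0 < β / κ := div_pos hβ hκ
  have hθ1 : 0 < 1 - β / κ := by rw [sub_pos, div_lt_one hκ]; exact hβκ
  -- first for positive `m` and `N`, where `δ = (N / m) ^ (1 / κ)` balances the two terms
  have hpos : ∀ η : ℝ, 0 < η → L ≤ 2 * A * ((m + η) ^ (1 - β / κ) * (N + η) ^ (β / κ)) := by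
    intro η hη
    have hm' : 0 < m + η := by linarith
    have hN' : 0 < N + η := by linarith
    set m' := m + η
    set N' := N + η
    have h1 := h ((N' / m') ^ (1 / κ)) (by positivity)
    have e1 : ((N' / m') ^ (1 / κ)) ^ β = N' ^ (β / κ) * m' ^ (-(β / κ)) := by
      rw [← Real.rpow_mul (by positivity), Real.div_rpow hN'.le hm'.le, Real.rpow_neg hm'.le,
        div_eq_mul_inv, one_div_mul_eq_div]
    have e2 : ((N' / m') ^ (1 / κ)) ^ (-(κ - β)) = N' ^ (β / κ - 1) * m' ^ (1 - β / κ) := by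
      have : 1 / κ * -(κ - β) = β / κ - 1 := by field_simp; ring
      rw [← Real.rpow_mul (by positivity), this, Real.div_rpow hN'.le hm'.le,
        ← neg_sub (1 : ℝ) (β / κ), Real.rpow_neg hm'.le, Real.rpow_neg hN'.le]
      field_simp
    calc L ≤ A * (m * ((N' / m') ^ (1 / κ)) ^ β + N * ((N' / m') ^ (1 / κ)) ^ (-(κ - β))) := h1
      _ ≤ A * (m' * ((N' / m') ^ (1 / κ)) ^ β + N' * ((N' / m') ^ (1 / κ)) ^ (-(κ - β))) := by
          gcongr <;> linarith
      _ = A * ((m' ^ (1 : ℝ) * m' ^ (-(β / κ))) * N' ^ (β / κ) +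
            (N' ^ (1 : ℝ) * N' ^ (β / κ - 1)) * m' ^ (1 - β / κ)) := by
          rw [e1, e2, Real.rpow_one, Real.rpow_one]; ring
      _ = 2 * A * (m' ^ (1 - β / κ) * N' ^ (β / κ)) := by
          rw [← Real.rpow_add hm', ← Real.rpow_add hN']
          ring_nf
  -- then `η → 0` allows `m` and `N` to vanish
  have hcont : ContinuousAt
      (fun η : ℝ => 2 * A * ((m + η) ^ (1 - β / κ) * (N + η) ^ (β / κ))) 0 := by
    refine continuousAt_const.mul (ContinuousAt.mul ?_ ?_)
    · exact (continuousAt_const.add continuousAt_id).rpow_const (Or.inr hθ1.le)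
    · exact (continuousAt_const.add continuousAt_id).rpow_const (Or.inr hθ.le)
  have hlim := hcont.tendsto.mono_left (nhdsWithin_le_nhds (s := Set.Ioi (0 : ℝ)))
  simp only [add_zero] at hlim
  exact ge_of_tendsto hlim (eventually_mem_nhdsWithin.mono hpos)

end AdditiveIntervalFunctions

/-! ### Existence of the principal value and a pointwise bound -/

section RoughOperator

open Metric Set Module

variable {n : ℕ} {Ω : sphere (0 : EuclideanSpace ℝ (Fin n)) 1 → ℝ} {α : ℝ}

theorem HasPrincipalValue.principalValue_eq {f : EuclideanSpace ℝ (Fin n) → ℝ} {L : ℝ}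
    (h : HasPrincipalValue f L) : principalValue f = L :=
  h.2.limUnder_eq

theorem setIntegral_annulus_add {f : EuclideanSpace ℝ (Fin n) → ℝ}
    (hf : ∀ ε R : ℝ, 0 < ε → IntegrableOn f (annulus n ε R)) {a b c : ℝ} (ha : 0 < a) (hab : a ≤ b)
    (hbc : b ≤ c) :
    ∫ y in annulus n a c, f y = (∫ y in annulus n a b, f y) + ∫ y in annulus n b c, f y := by
  have hb : 0 < b := ha.trans_le hab
  have hdisj : Disjoint (annulus n a b) (annulus n b c) :=
    Set.disjoint_left.2 fun y hy hy' => lt_asymm hy.2 hy'.1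
  rw [← setIntegral_union hdisj (measurableSet_annulus b c) (hf a b ha) (hf b c hb)]
  -- the two sets differ by a subset of the sphere of radius `b`
  refine setIntegral_congr_set ?_
  have hnull : ∀ᵐ y : EuclideanSpace ℝ (Fin n), y ∉ sphere (0 : EuclideanSpace ℝ (Fin n)) b :=
    measure_eq_zero_iff_ae_notMem.1 (Measure.addHaar_sphere_of_ne_zero volume 0 hb.ne')
  filter_upwards [hnull] with y hy
  rw [mem_sphere_zero_iff_norm] at hy
  apply propext
  change (a < ‖y‖ ∧ ‖y‖ < c) ↔ (a < ‖y‖ ∧ ‖y‖ < b) ∨ (b < ‖y‖ ∧ ‖y‖ < c)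
  constructor
  · rintro ⟨h1, h2⟩
    rcases lt_or_gt_of_ne hy with h | h
    · exact Or.inl ⟨h1, h⟩
    · exact Or.inr ⟨h, h2⟩
  · rintro (⟨h1, h2⟩ | ⟨h1, h2⟩)
    · exact ⟨h1, h2.trans_le hbc⟩
    · exact ⟨hab.trans_lt h1, h2⟩

/-- Existence of the principal value at every point, with a bound of Hedberg's type: small scales are
controlled by the maximal function of `‖∇φ‖ ^ p`, large scales by the `L^q` norm of `∇φ`. -/
theorem exists_hasPrincipalValue_enorm_le [Nontrivial (EuclideanSpace ℝ (Fin n))]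
    (hα0 : 0 < 1 + α) (hα : α < n) {ρ p q : ℝ} (hρ : 1 < ρ) (hp : 1 ≤ p)
    (hpρ : (ρ.conjExponent)⁻¹ = p⁻¹ - (n : ℝ)⁻¹) (hpq : p ≤ q) (hq : 1 + α < n / q)
    (hΩ : MemLp Ω (ENNReal.ofReal ρ) (volume : Measure (EuclideanSpace ℝ (Fin n))).toSphere)
    (hΩ0 : ∫ ξ, Ω ξ ∂(volume : Measure (EuclideanSpace ℝ (Fin n))).toSphere = 0) :
    ∃ C : ℝ≥0, ∀ φ : EuclideanSpace ℝ (Fin n) → ℝ, ContDiff ℝ 1 φ →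
      eLpNorm (fderiv ℝ φ) (ENNReal.ofReal q) volume < ∞ →
      ∀ x : EuclideanSpace ℝ (Fin n), ∃ L : ℝ,
        HasPrincipalValue (fun y => roughKernel Ω α y * φ (x - y)) L ∧
        ‖L‖ₑ ≤ C * ((maximalFunction volume (fun y => ‖fderiv ℝ φ y‖ₑ ^ p) x ^ (1 / p)) ^
            (1 - (1 + α) / (n / q)) *
          eLpNorm (fderiv ℝ φ) (ENNReal.ofReal q) volume ^ ((1 + α) / (n / q))) := by
  have hp0 : 0 < p := by linarith
  have hq0 : 0 < q := by linarith
  have hκβ : 0 < n / q - (1 + α) := by linarith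
  have hκ : 0 < n / q := by linarith
  have hθ : 0 ≤ (1 + α) / (n / q) := by positivity
  have hθ1 : 0 ≤ 1 - (1 + α) / (n / q) := by
    rw [sub_nonneg, div_le_one hκ]
    exact hq.le
  have hΩ1 : Integrable Ω (volume : Measure (EuclideanSpace ℝ (Fin n))).toSphere :=
    hΩ.integrable (by simpa using hρ.le)
  obtain ⟨C, hC⟩ := exists_enorm_setIntegral_annulus_le hα hρ hp hpρ hΩ hΩ0
  set W : ℝ≥0∞ := (volume (ball (0 : EuclideanSpace ℝ (Fin n)) 3))⁻¹ ^ (1 / q) with hW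
  have hWtop : W ≠ ∞ := ENNReal.rpow_ne_top_of_nonneg (by positivity)
    (ENNReal.inv_ne_top.2 (measure_ball_pos volume _ (by norm_num)).ne')
  set γ := n / q - (1 + α) with hγ
  set A₁ : ℝ := C / (1 - 2 ^ (-(1 + α)))
  set A₂ : ℝ := C * W.toReal / (1 - 2 ^ (-γ))
  have hA₁ : 0 ≤ A₁ := div_nonneg C.coe_nonneg (by linarith [two_rpow_neg_lt_one hα0])
  have hA₂ : 0 ≤ A₂ := div_nonneg (mul_nonneg C.coe_nonneg ENNReal.toReal_nonneg)
    (by linarith [two_rpow_neg_lt_one hκβ])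
  refine ⟨(2 * (A₁ + A₂)).toNNReal, fun φ hφ hφq x => ?_⟩
  have hfd : Continuous (fderiv ℝ φ) := hφ.continuous_fderiv one_ne_zero
  set M := maximalFunction volume (fun y => ‖fderiv ℝ φ y‖ₑ ^ p) x ^ (1 / p)
  have hM : M ≠ ∞ := ENNReal.rpow_ne_top_of_nonneg (by positivity)
    (maximalFunction_enorm_rpow_lt_top volume hfd hp0 hpq hφq x).ne
  set N := eLpNorm (fderiv ℝ φ) (ENNReal.ofReal q) volume with hN
  have hint : ∀ ε R : ℝ, 0 < ε →
      IntegrableOn (fun y => roughKernel Ω α y * φ (x - y)) (annulus n ε R) := fun ε R hε =>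
    integrableOn_roughKernel_mul hα hΩ1 (hφ.continuous.comp (by fun_prop)) hε R
  have hsmall : ∀ a b, 0 < a → a ≤ b → b ≤ 2 * a →
      |∫ y in annulus n a b, roughKernel Ω α y * φ (x - y)| ≤ C * M.toReal * a ^ (1 + α) := by
    intro a b ha _ hb
    have h1 := (hC φ hφ x a b ha hb).trans (mul_le_mul_right (ENNReal.rpow_le_rpow
      (setLAverage_le_maximalFunction volume _ x (by positivity)) (by positivity)) _)
    have h2 := ENNReal.toReal_mono (by finiteness) h1
    rw [toReal_enorm, Real.norm_eq_abs, ENNReal.toReal_mul, ENNReal.toReal_mul,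
      ENNReal.toReal_ofReal (by positivity), ENNReal.coe_toReal] at h2
    exact h2.trans (le_of_eq (by ring))
  have hlarge : ∀ a b, 0 < a → a ≤ b → b ≤ 2 * a →
      |∫ y in annulus n a b, roughKernel Ω α y * φ (x - y)| ≤
        C * W.toReal * N.toReal * a ^ (-γ) := by
    intro a b ha _ hb
    have h1 := (hC φ hφ x a b ha hb).trans (mul_le_mul_right (setLAverage_rpow_le_eLpNorm volume
      hfd.aestronglyMeasurable hp0 hpq x (by positivity)) _)
    have h3 : (volume (ball x (a * 3)))⁻¹ ^ (1 / q) = ENNReal.ofReal (a ^ (-(n / q))) * W := by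
      have hpow : (0 : ℝ) < a ^ n := by positivity
      rw [Measure.addHaar_ball_mul_of_pos volume x ha 3, finrank_euclideanSpace, Fintype.card_fin,
        ENNReal.mul_inv (Or.inr measure_ball_lt_top.ne) (Or.inl ENNReal.ofReal_ne_top),
        ENNReal.mul_rpow_of_nonneg _ _ (by positivity), ← ENNReal.ofReal_inv_of_pos hpow,
        ENNReal.ofReal_rpow_of_nonneg (by positivity) (by positivity), ← Real.rpow_natCast,
        ← Real.rpow_neg ha.le, ← Real.rpow_mul ha.le]
      congr 3
      ring
    rw [h3] at h1
    have h2 := ENNReal.toReal_mono (by finiteness) h1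
    rw [toReal_enorm, Real.norm_eq_abs, ENNReal.toReal_mul, ENNReal.toReal_mul, ENNReal.toReal_mul,
      ENNReal.toReal_mul, ENNReal.toReal_ofReal (by positivity),
      ENNReal.toReal_ofReal (by positivity), ENNReal.coe_toReal] at h2
    refine h2.trans (le_of_eq ?_)
    have h4 : a ^ (-γ) = a ^ (1 + α) * a ^ (-(n / q)) := by
      rw [← Real.rpow_add ha]
      congr 1
      rw [hγ]
      ring
    rw [h4]
    ring
  obtain ⟨L, hL, hLle⟩ := exists_tendsto_of_doubling
    (G := fun a b => ∫ y in annulus n a b, roughKernel Ω α y * φ (x - y))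
    (fun a b c => setIntegral_annulus_add hint) hα0 hκβ
    (mul_nonneg C.coe_nonneg ENNReal.toReal_nonneg)
    (mul_nonneg (mul_nonneg C.coe_nonneg ENNReal.toReal_nonneg) ENNReal.toReal_nonneg) hsmall hlarge
  refine ⟨L, ⟨hint, hL⟩, ?_⟩
  have hopt := le_two_mul_rpow_of_forall_le (L := |L|) (A := A₁ + A₂) (m := M.toReal)
    (N := N.toReal) (β := 1 + α) (κ := n / q) (by positivity) ENNReal.toReal_nonneg
    ENNReal.toReal_nonneg hα0 hq fun δ hδ => by
      refine (hLle δ hδ).trans ?_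
      have e1 : C * M.toReal / (1 - 2 ^ (-(1 + α))) * δ ^ (1 + α) =
          A₁ * (M.toReal * δ ^ (1 + α)) := by simp only [A₁]; ring
      have e2 : C * W.toReal * N.toReal / (1 - 2 ^ (-γ)) * δ ^ (-γ) =
          A₂ * (N.toReal * δ ^ (-γ)) := by simp only [A₂]; ring
      rw [e1, e2]
      have h1 : 0 ≤ M.toReal * δ ^ (1 + α) := by positivity
      have h2 : 0 ≤ N.toReal * δ ^ (-γ) := by positivity
      nlinarith [mul_nonneg hA₁ h2, mul_nonneg hA₂ h1]
  rw [← ofReal_norm, Real.norm_eq_abs]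
  refine (ENNReal.ofReal_le_ofReal hopt).trans (le_of_eq ?_)
  rw [ENNReal.ofReal_mul (show 0 ≤ 2 * (A₁ + A₂) by positivity),
    ENNReal.ofReal_mul (show 0 ≤ M.toReal ^ (1 - (1 + α) / (n / q)) by positivity),
    ← ENNReal.ofReal_rpow_of_nonneg ENNReal.toReal_nonneg hθ1,
    ← ENNReal.ofReal_rpow_of_nonneg ENNReal.toReal_nonneg hθ, ENNReal.ofReal_toReal hM,
    ENNReal.ofReal_toReal hφq.ne]
  rfl

theorem aestronglyMeasurable_of_hasPrincipalValue [Nontrivial (EuclideanSpace ℝ (Fin n))]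
    (hΩ : AEStronglyMeasurable Ω (volume : Measure (EuclideanSpace ℝ (Fin n))).toSphere)
    {φ T : EuclideanSpace ℝ (Fin n) → ℝ} (hφ : Continuous φ)
    (hT : ∀ x, HasPrincipalValue (fun y => roughKernel Ω α y * φ (x - y)) (T x)) :
    AEStronglyMeasurable T volume := by
  have hseq : Tendsto (fun k : ℕ => ((1 : ℝ) / ((k : ℝ) + 1), (k : ℝ))) atTop
      (𝓝[>] (0 : ℝ) ×ˢ atTop) := by
    refine Tendsto.prodMk ?_ tendsto_natCast_atTop_atTop
    refine tendsto_nhdsWithin_iff.2 ⟨tendsto_one_div_add_atTop_nhds_zero_nat, ?_⟩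
    exact Eventually.of_forall fun k => by simp only [mem_Ioi]; positivity
  refine aestronglyMeasurable_of_tendsto_ae atTop (fun k => ?_)
    (Eventually.of_forall fun x => (hT x).2.comp hseq)
  have hK : AEStronglyMeasurable (roughKernel Ω α)
      (volume.restrict (annulus n (1 / ((k : ℝ) + 1)) k)) :=
    (aestronglyMeasurable_roughKernel hΩ).restrict
  have hprod : AEStronglyMeasurable
      (fun z : EuclideanSpace ℝ (Fin n) × EuclideanSpace ℝ (Fin n) =>
        roughKernel Ω α z.2 * φ (z.1 - z.2))
      ((volume : Measure (EuclideanSpace ℝ (Fin n))).prod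
        (volume.restrict (annulus n (1 / ((k : ℝ) + 1)) k))) :=
    hK.comp_snd.mul (hφ.comp (by fun_prop)).aestronglyMeasurable
  exact hprod.integral_prod_right'

end RoughOperator

/-! ### From the pointwise bound to the norm inequality -/

section NormEstimate

open Metric Set Module

variable {E : Type*} [NormedAddCommGroup E] [NormedSpace ℝ E] [MeasurableSpace E] [BorelSpace E]
  [FiniteDimensional ℝ E] [Nontrivial E] (μ : Measure E) [μ.IsAddHaarMeasure]

/-- A pointwise bound of Hedberg's type gives an `L^q → L^s` bound through the maximal theorem. -/
theorem exists_eLpNorm_le_of_enorm_le_maximalFunction {F : Type*} [NormedAddCommGroup F]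
    {p q s θ : ℝ} (hp : 0 < p) (hpq : p < q) (hθ0 : 0 ≤ θ) (hs : 0 < s)
    (hsθ : q / s = 1 - θ) (C : ℝ≥0) :
    ∃ C' : ℝ≥0, ∀ (f : E → F) (T : E → ℝ), Continuous f → eLpNorm f (ENNReal.ofReal q) μ < ∞ →
      (∀ x, ‖T x‖ₑ ≤ C * ((maximalFunction μ (fun y => ‖f y‖ₑ ^ p) x ^ (1 / p)) ^ (1 - θ) *
        eLpNorm f (ENNReal.ofReal q) μ ^ θ)) →
      eLpNorm T (ENNReal.ofReal s) μ ≤ C' * eLpNorm f (ENNReal.ofReal q) μ := by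
  have hq : 0 < q := hp.trans hpq
  have hθ1 : 0 < 1 - θ := by rw [← hsθ]; positivity
  obtain ⟨K, hK⟩ := lintegral_maximalFunction_rpow_le μ ((one_lt_div hp).2 hpq)
  refine ⟨C * K ^ (1 / s), fun f T hf hfq hT => ?_⟩
  set N := eLpNorm f (ENNReal.ofReal q) μ with hN
  set M := maximalFunction μ (fun y => ‖f y‖ₑ ^ p)
  have hNq : ∫⁻ x, ‖f x‖ₑ ^ q ∂μ = N ^ q := by
    rw [hN, eLpNorm_eq_lintegral_rpow_enorm_toReal (by simpa using hq) ENNReal.ofReal_ne_top,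
      ENNReal.toReal_ofReal hq.le, ← ENNReal.rpow_mul, one_div_mul_cancel hq.ne',
      ENNReal.rpow_one]
  have hMq : ∫⁻ x, M x ^ (q / p) ∂μ ≤ K * N ^ q := by
    refine (hK _ (hf.enorm.measurable.pow_const p) (fun x => by finiteness) fun x =>
      (maximalFunction_enorm_rpow_lt_top μ hf hp hpq.le hfq x).ne).trans (le_of_eq ?_)
    rw [← hNq]
    congr 1
    refine lintegral_congr fun x => ?_
    rw [← ENNReal.rpow_mul, mul_div_cancel₀ _ hp.ne']
  have hexp : 1 / p * ((1 - θ) * s) = q / p := by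
    rw [← hsθ]
    field_simp
  rw [eLpNorm_eq_lintegral_rpow_enorm_toReal (by simpa using hs) ENNReal.ofReal_ne_top,
    ENNReal.toReal_ofReal hs.le]
  calc (∫⁻ x, ‖T x‖ₑ ^ s ∂μ) ^ (1 / s)
      ≤ (∫⁻ x, (C * N ^ θ) ^ s * M x ^ (q / p) ∂μ) ^ (1 / s) := by
        gcongr with x
        refine (ENNReal.rpow_le_rpow (hT x) hs.le).trans (le_of_eq ?_)
        rw [mul_comm (_ ^ (1 - θ)), ← mul_assoc, ENNReal.mul_rpow_of_nonneg _ _ hs.le,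
          ← ENNReal.rpow_mul, ← ENNReal.rpow_mul, hexp]
    _ ≤ ((C * N ^ θ) ^ s * (K * N ^ q)) ^ (1 / s) := by
        rw [lintegral_const_mul' _ _ (by finiteness)]
        gcongr
    _ = C * K ^ (1 / s) * (N ^ θ * N ^ (q / s)) := by
        rw [ENNReal.mul_rpow_of_nonneg _ _ (by positivity), ← ENNReal.rpow_mul,
          mul_one_div_cancel hs.ne', ENNReal.rpow_one,
          ENNReal.mul_rpow_of_nonneg _ _ (by positivity), ← ENNReal.rpow_mul, mul_one_div]
        ring
    _ = _ := by
        rw [hsθ, ← ENNReal.rpow_add_of_nonneg _ _ hθ0 hθ1.le, add_sub_cancel, ENNReal.rpow_one,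
          ENNReal.coe_mul, ENNReal.coe_rpow_of_nonneg _ (by positivity)]

end NormEstimate

theorem norm_gradient_eq_norm_fderiv {F : Type*} [NormedAddCommGroup F] [InnerProductSpace ℝ F]
    [CompleteSpace F] (φ : F → ℝ) (x : F) : ‖gradient φ x‖ = ‖fderiv ℝ φ x‖ :=
  LinearIsometryEquiv.norm_map _ _

theorem proposition1 (n : ℕ) (α ρ q s : ℝ)
    (hα0 : 0 < α) (hα : α < (n : ℝ) - 1)
    (hρ1 : 1 < ρ) (hρ : ρ < (n : ℝ))
    (hq1 : ρ * n / (ρ * n + ρ - n) < q) (hq : q < (n : ℝ) / (1 + α))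
    (hs : s = q * n / (n - q * (1 + α)))
    (Ω : Metric.sphere (0 : EuclideanSpace ℝ (Fin n)) 1 → ℝ)
    (hΩ : MemLp Ω (ENNReal.ofReal ρ) (volume : Measure (EuclideanSpace ℝ (Fin n))).toSphere)
    (hΩ0 : ∫ ξ, Ω ξ ∂(volume : Measure (EuclideanSpace ℝ (Fin n))).toSphere = 0) :
    1 < ρ * n / (ρ * n + ρ - n) ∧ 1 < s ∧
    ∃ C : ℝ≥0, ∀ φ : EuclideanSpace ℝ (Fin n) → ℝ, ContDiff ℝ 1 φ →
      MemLp (gradient φ) (ENNReal.ofReal q) volume →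
        (∀ x : EuclideanSpace ℝ (Fin n),
          HasPrincipalValue (fun y => roughKernel Ω α y * φ (x - y)) (roughOperator Ω α φ x)) ∧
        MemLp (roughOperator Ω α φ) (ENNReal.ofReal s) volume ∧
        eLpNorm (roughOperator Ω α φ) (ENNReal.ofReal s) volume
          ≤ C * eLpNorm (gradient φ) (ENNReal.ofReal q) volume := by
  have hn0 : (0 : ℝ) < n := by linarith
  have hden : 0 < ρ * n + ρ - n := by nlinarith
  set p := ρ * n / (ρ * n + ρ - n) with hp
  have hp1 : 1 < p := by
    rw [hp, one_lt_div hden]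
    linarith
  have hq0 : 0 < q := by linarith
  have hα1 : 0 < 1 + α := by linarith
  have hqα : q * (1 + α) < n := (lt_div_iff₀ hα1).1 hq
  have hsden : 0 < n - q * (1 + α) := by linarith
  have hs1 : 1 < s := by
    rw [hs, one_lt_div hsden]
    nlinarith
  refine ⟨hp1, hs1, ?_⟩
  have hpρ : (ρ.conjExponent)⁻¹ = p⁻¹ - (n : ℝ)⁻¹ := by
    have : ρ - 1 ≠ 0 := by linarith
    rw [hp, Real.conjExponent]
    field_simp
    ring
  have hnq : 1 + α < n / q := by
    rw [lt_div_iff₀ hq0]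
    linarith
  have hθ : q / s = 1 - (1 + α) / (n / q) := by
    rw [hs]
    field_simp
  have hnt : Nontrivial (EuclideanSpace ℝ (Fin n)) := by
    apply Module.nontrivial_of_finrank_pos (R := ℝ)
    rw [finrank_euclideanSpace, Fintype.card_fin]
    exact_mod_cast hn0
  obtain ⟨C, hC⟩ := exists_hasPrincipalValue_enorm_le hα1 (by linarith) hρ1 hp1.le hpρ hq1.le hnq
    hΩ hΩ0
  obtain ⟨C', hC'⟩ := exists_eLpNorm_le_of_enorm_le_maximalFunction
    (F := EuclideanSpace ℝ (Fin n) →L[ℝ] ℝ) (volume : Measure (EuclideanSpace ℝ (Fin n)))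
    (by linarith) hq1 (by positivity) (by linarith) hθ C
  refine ⟨C', fun φ hφ hgrad => ?_⟩
  have hnorm : eLpNorm (gradient φ) (ENNReal.ofReal q) volume =
      eLpNorm (fderiv ℝ φ) (ENNReal.ofReal q) volume :=
    eLpNorm_congr_norm_ae (Eventually.of_forall (norm_gradient_eq_norm_fderiv φ))
  have hfin := hgrad.2
  rw [hnorm] at hfin ⊢
  have hPV : ∀ x, HasPrincipalValue (fun y => roughKernel Ω α y * φ (x - y))
      (roughOperator Ω α φ x) := by
    intro x
    obtain ⟨L, hL, -⟩ := hC φ hφ hfin x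
    rwa [roughOperator, hL.principalValue_eq]
  have hbound := hC' (fderiv ℝ φ) (roughOperator Ω α φ) (hφ.continuous_fderiv one_ne_zero) hfin
    fun x => by
      obtain ⟨L, hL, hle⟩ := hC φ hφ hfin x
      rwa [roughOperator, hL.principalValue_eq]
  exact ⟨hPV, ⟨aestronglyMeasurable_of_hasPrincipalValue hΩ.1 hφ.continuous hPV,
    hbound.trans_lt (by finiteness)⟩, hbound⟩
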